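/- Let $S=\mathbb R\times\mathbb T$ with $\mathbb T=\mathbb R/2\pi\mathbb Z$, write $z=(x,y)\in S$ and $dz=dx\,dy$, and let $$k(x,y)=(k_1,k_2)=\frac{(-\sin y,\ \sinh x)}{2(\cosh x-\cos y)} .$$ There is an absolute constant $C>0$ with the following property. Let $\theta_0:S\to\mathbb R$ be measurable with compact essential support, and suppose that $$0\le\theta_0\le 1 \text{ a.e.},\qquad \sup\{|x-\xi_1| : (x,y),(\xi_1,\xi_2)\in\operatorname{supp}\theta_0\}\le 1,\qquad \int_S\theta_0\,dz>0,\qquad \int_S x\,\theta_0\,dz=0,$$ where $\operatorname{supp}$ is the essential support. Let $\theta(z,t)$, $t\ge 0$, be a solution in the sense of distributions of the Euler equation on the cylinder $$\partial_t\theta+u\cdot\nabla\theta=0,\qquad u=k*\theta,\qquad \theta|_{t=0}=\theta_0,$$ which on every bounded time interval is bounded and supported in a fixed compact subset of $S$; that is, for all $\varphi\in C_c^\infty(\mathbb R\times S)$ and all $t\ge0$, $$\int_S\theta(z,t)\varphi(z,t)\,dz=\int_S\theta_0(z)\varphi(z,0)\,dz+\int_0^t\!\int_S\theta\,(\partial_\tau\varphi+u\cdot\nabla\varphi)\,dz\,d\tau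 .$$ Then for every even integer $a\ge 2$ and every $t\ge 0$, $$\int_{|x|>2a}\theta(z,t)\,dz\le C\,a^{-2}\int_0^t\left(\Big(\int_{|x|>a/2}\theta(z,\tau)\,dz\Big)^2+e^{-a/4}\int_{|x|>a/2}\theta(z,\tau)\,dz\right)d\tau .$$ -/

import Mathlib

open MeasureTheory Set Topology
open scoped ContDiff

namespace CylinderEuler

instance fact_two_pi_pos : Fact ((0 : ℝ) < 2 * Real.pi) := ⟨Real.two_pi_pos⟩

/-- The infinite cylinder `S = ℝ × 𝕋`, where `𝕋 = ℝ / 2πℤ`. Its `volume` is `dx dy`; the circle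
has total mass `2π`. -/
abbrev Cyl : Type := ℝ × AddCircle (2 * Real.pi)

/-- The sine of a point of the circle `ℝ / 2πℤ`. -/
noncomputable def circSin : AddCircle (2 * Real.pi) → ℝ := Real.sin_periodic.lift

/-- The cosine of a point of the circle `ℝ / 2πℤ`. -/
noncomputable def circCos : AddCircle (2 * Real.pi) → ℝ := Real.cos_periodic.lift

/-- The horizontal component `- sin y / (2 (cosh x - cos y))` of the Biot-Savart kernel. -/
noncomputable def k₁ (z : Cyl) : ℝ :=
  -circSin z.2 / (2 * (Real.cosh z.1 - circCos z.2))

/-- The vertical component `sinh x / (2 (cosh x - cos y))` of the Biot-Savart kernel. -/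
noncomputable def k₂ (z : Cyl) : ℝ :=
  Real.sinh z.1 / (2 * (Real.cosh z.1 - circCos z.2))

/-- The horizontal velocity `u₁ = k₁ * f` generated by the vorticity `f`. -/
noncomputable def u₁ (f : Cyl → ℝ) (z : Cyl) : ℝ := ∫ ξ : Cyl, k₁ (z - ξ) * f ξ

/-- The vertical velocity `u₂ = k₂ * f` generated by the vorticity `f`. -/
noncomputable def u₂ (f : Cyl → ℝ) (z : Cyl) : ℝ := ∫ ξ : Cyl, k₂ (z - ξ) * f ξ

/-- Smooth compactly supported real functions of `(t, z) ∈ ℝ × S`. Smoothness is read in the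
coordinates `(t, x, y) ∈ ℝ³`, through the covering `ℝ → ℝ / 2πℤ` of the circle. -/
structure IsTestFunction (φ : ℝ → Cyl → ℝ) : Prop where
  smooth : ContDiff ℝ ∞
    (fun p : ℝ × ℝ × ℝ => φ p.1 (p.2.1, (p.2.2 : AddCircle (2 * Real.pi))))
  compact : HasCompactSupport (fun p : ℝ × Cyl => φ p.1 p.2)

/-- The partial derivative `∂φ/∂t`. -/
noncomputable def dt (φ : ℝ → Cyl → ℝ) (t : ℝ) (z : Cyl) : ℝ :=
  deriv (fun s : ℝ => φ s z) t

/-- The partial derivative `∂f/∂x` of a function on the cylinder. -/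
noncomputable def dx (f : Cyl → ℝ) (z : Cyl) : ℝ :=
  deriv (fun s : ℝ => f (s, z.2)) z.1

/-- The partial derivative `∂f/∂y` of a function on the cylinder. -/
noncomputable def dy (f : Cyl → ℝ) (z : Cyl) : ℝ :=
  deriv (fun h : ℝ => f (z.1, z.2 + (h : AddCircle (2 * Real.pi)))) 0

/-- `θ` is a bounded, compactly supported solution, in the sense of distributions, of
`∂ₜθ + u · ∇θ = 0`, `u = k * θ`, on `S × [0, ∞)` with initial datum `θ₀`. Boundedness and
compactness of the support are uniform on bounded time intervals. The velocity is
divergence free, so `u · ∇θ = div (u θ)` and the equation is tested against `φ ∈ C_c^∞`. The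
identity is written at every time `t`, which singles out the weakly continuous representative
`t ↦ θ (t)`; with `t` beyond the support of `φ` it is the usual distributional identity
`∫₀^∞ ∫ θ (∂ₜφ + u · ∇φ) dz dτ + ∫ θ₀ φ(·, 0) dz = 0`.
Values of `θ` at negative times play no role. -/
structure IsWeakSolution (θ₀ : Cyl → ℝ) (θ : ℝ → Cyl → ℝ) : Prop where
  aestronglyMeasurable_joint : AEStronglyMeasurable (fun p : ℝ × Cyl => θ p.1 p.2)
    ((volume.restrict (Ici (0 : ℝ))).prod (volume : Measure Cyl))
  aestronglyMeasurable_slice : ∀ t, 0 ≤ t → AEStronglyMeasurable (θ t) volume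
  bounded_compact : ∀ T : ℝ, ∃ M R : ℝ, ∀ t ∈ Icc 0 T,
    ∀ᵐ z : Cyl, |θ t z| ≤ M ∧ (R < |z.1| → θ t z = 0)
  weak_form : ∀ φ : ℝ → Cyl → ℝ, IsTestFunction φ → ∀ t : ℝ, 0 ≤ t →
    ∫ z : Cyl, θ t z * φ t z =
      (∫ z : Cyl, θ₀ z * φ 0 z) +
        ∫ τ in (0 : ℝ)..t, ∫ z : Cyl, θ τ z *
          (dt φ τ z + u₁ (θ τ) z * dx (φ τ) z + u₂ (θ τ) z * dy (φ τ) z)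

/-- The essential support of `f`: the points near which `f` is nowhere a.e. zero, i.e. the
complement of the largest open set on which `f` vanishes almost everywhere. -/
def essSupport (f : Cyl → ℝ) : Set Cyl :=
  {z | ∀ U ∈ 𝓝 z, ¬ (∀ᵐ w ∂(volume.restrict U), f w = 0)}

/-- `d_f`, the supremum of `|x - ξ₁|` over points `z = (x, y)`, `ξ = (ξ₁, ξ₂)` of the essential
support of `f`. -/
noncomputable def horizDiam (f : Cyl → ℝ) : ℝ :=
  sSup {d : ℝ | ∃ z ∈ essSupport f, ∃ ξ ∈ essSupport f, d = |z.1 - ξ.1|}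

/-- The mass `∫_{|x| > r} f dz`. -/
noncomputable def outerMass (f : Cyl → ℝ) (r : ℝ) : ℝ :=
  ∫ z in {z : Cyl | r < |z.1|}, f z

end CylinderEuler

/-! Test the equation with `χ(x) = η(x / a)`, where `η` vanishes on `|x| ≤ 1` and equals `1` on `|x|
≥ 2`. The datum does not see `χ`, so the mass beyond `2a` is at most the time integral of the flux
`∫ θ u₁ χ'`. Since `k₁` is odd, the flux equals half the double integral of `θ(z) θ(ξ) k₁(z - ξ)
(χ'(x) - χ'(ξ₁))`. Here `χ'` has Lipschitz constant `O(a⁻²)`, and `|x| |k₁|` is bounded by `1` and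
decays exponentially. If both points lie in `|x| > a/2`, the bounded kernel gives the squared mass.
If only one does, the difference of `χ'` vanishes unless that point has `|x| ≥ a`; the two points
are then at least `a/2` apart, which yields `e^(-a/4)` times the total mass. Total mass is conserved
and at most the area of `|x| ≤ 1`, because the datum is centred, has diameter at most one and is
bounded by `1`. The lemmas are `abs_k₁_mul_sub_le`, `BddStrip.abs_integral_flux_le` and
`IsWeakSolution.outerMass_le`.

The argument needs `θ ≥ 0` at later times, which is not assumed, and this takes up most of the work.
A nonnegative test function `g` is transported backward by Euler steps along the velocity with
kernel regularized at scale `e`. Each step preserves nonnegativity of `g`. Replacing the velocity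
costs `O(e^(1/4))` times the gradient of `g`. The regularized velocity has Lipschitz constant `O(1 -
log e)`, so on a short interval of fixed length the gradient grows at most like `e^(-1/8)`. The
total error is `O(e^(1/8))` and vanishes as `e → 0`. Hence `θ(t)` pairs nonnegatively with every
such `g`, and finitely many short intervals cover `[0, T]`
(`IsWeakSolution.exists_time_integral_mul_nonneg`, `IsWeakSolution.ae_nonneg`). -/

namespace CylinderEuler

/-! ### ### Trigonometry on the circle and the denominator of the kernel -/

@[simp] theorem circSin_coe (r : ℝ) : circSin (r : AddCircle (2 * Real.pi)) = Real.sin r := rfl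

@[simp] theorem circCos_coe (r : ℝ) : circCos (r : AddCircle (2 * Real.pi)) = Real.cos r := rfl

theorem continuous_circSin : Continuous circSin :=
  continuous_coinduced_dom.mpr Real.continuous_sin

theorem continuous_circCos : Continuous circCos :=
  continuous_coinduced_dom.mpr Real.continuous_cos

theorem exists_coe_eq_norm (y : AddCircle (2 * Real.pi)) :
    ∃ r : ℝ, |r| ≤ Real.pi ∧ (r : AddCircle (2 * Real.pi)) = y ∧ ‖y‖ = |r| := by
  obtain ⟨r, hr, rfl⟩ := (AddCircle.coe_image_Ioc_eq (2 * Real.pi) (-Real.pi)).symm.subset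
    (mem_univ y)
  have h : |r| ≤ Real.pi := abs_le.2 ⟨hr.1.le, by linarith [hr.2]⟩
  refine ⟨r, h, rfl, ?_⟩
  rw [AddCircle.norm_coe_eq_abs_iff _ Real.two_pi_pos.ne', abs_of_pos Real.two_pi_pos]
  linarith

theorem norm_coe_of_abs_le {r : ℝ} (h : |r| ≤ Real.pi) :
    ‖(r : AddCircle (2 * Real.pi))‖ = |r| := by
  rw [AddCircle.norm_coe_eq_abs_iff _ Real.two_pi_pos.ne', abs_of_pos Real.two_pi_pos]
  linarith

theorem circSin_sq_add_circCos_sq (y : AddCircle (2 * Real.pi)) :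
    circSin y ^ 2 + circCos y ^ 2 = 1 := by
  obtain ⟨r, -, rfl, -⟩ := exists_coe_eq_norm y
  exact Real.sin_sq_add_cos_sq r

theorem circCos_le_one (y : AddCircle (2 * Real.pi)) : circCos y ≤ 1 := by
  nlinarith [circSin_sq_add_circCos_sq y, sq_nonneg (circSin y)]

theorem neg_one_le_circCos (y : AddCircle (2 * Real.pi)) : -1 ≤ circCos y := by
  nlinarith [circSin_sq_add_circCos_sq y, sq_nonneg (circSin y)]

theorem circSin_neg (y : AddCircle (2 * Real.pi)) : circSin (-y) = -circSin y := by
  obtain ⟨r, -, rfl, -⟩ := exists_coe_eq_norm y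
  exact Real.sin_neg r

theorem circCos_neg (y : AddCircle (2 * Real.pi)) : circCos (-y) = circCos y := by
  obtain ⟨r, -, rfl, -⟩ := exists_coe_eq_norm y
  exact Real.cos_neg r

/-- Jordan-type bound `cos r ≤ 1 - 2 r² / π²` on `[-π, π]`; the constant `1/5` comes from `π² < 10`.
-/
theorem norm_sq_le_one_sub_circCos (y : AddCircle (2 * Real.pi)) :
    ‖y‖ ^ 2 / 5 ≤ 1 - circCos y := by
  obtain ⟨r, hr, rfl, h⟩ := exists_coe_eq_norm y
  rw [h, circCos_coe, sq_abs]
  have h1 := Real.cos_le_one_sub_mul_cos_sq hr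
  have h2 : (1 : ℝ) / 5 ≤ 2 / Real.pi ^ 2 := by
    rw [div_le_div_iff₀ (by norm_num) (by positivity)]
    nlinarith [Real.pi_lt_d2, Real.pi_pos]
  nlinarith [mul_le_mul_of_nonneg_right h2 (sq_nonneg r)]

theorem half_sq_le_cosh_sub_one (x : ℝ) : x ^ 2 / 2 ≤ Real.cosh x - 1 := by
  have h := Real.cosh_sq' (x / 2)
  have h2 : Real.cosh x = Real.cosh (x / 2) ^ 2 + Real.sinh (x / 2) ^ 2 := by
    rw [← Real.cosh_two_mul]; ring_nf
  have h3 : (x / 2) ^ 2 ≤ Real.sinh (x / 2) ^ 2 := by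
    apply sq_le_sq.2
    rcases le_total 0 (x / 2) with h0 | h0
    · rw [abs_of_nonneg h0, abs_of_nonneg (Real.sinh_nonneg_iff.2 h0)]
      exact Real.self_le_sinh_iff.2 h0
    · rw [abs_of_nonpos h0, abs_of_nonpos (Real.sinh_nonpos_iff.2 h0)]
      exact neg_le_neg (Real.sinh_le_self_iff.2 h0)
  nlinarith

/-- The function `cosh x - cos y`, comparable to `x² + y²` near the origin. -/
noncomputable def den (z : Cyl) : ℝ := Real.cosh z.1 - circCos z.2

theorem continuous_den : Continuous den :=
  (Real.continuous_cosh.comp continuous_fst).sub (continuous_circCos.comp continuous_snd)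

theorem half_sq_le_den (z : Cyl) : z.1 ^ 2 / 2 ≤ den z := by
  have := half_sq_le_cosh_sub_one z.1
  have := circCos_le_one z.2
  unfold den; linarith

theorem sq_add_sq_le_den (z : Cyl) : (z.1 ^ 2 + ‖z.2‖ ^ 2) / 5 ≤ den z := by
  have := half_sq_le_cosh_sub_one z.1
  have := norm_sq_le_one_sub_circCos z.2
  unfold den; nlinarith [sq_nonneg z.1]

theorem den_nonneg (z : Cyl) : 0 ≤ den z := le_trans (by positivity) (sq_add_sq_le_den z)

theorem circSin_sq_le_den (z : Cyl) : circSin z.2 ^ 2 ≤ 2 * den z := by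
  have h1 := Real.one_le_cosh z.1
  have h2 := circCos_le_one z.2
  have h3 := neg_one_le_circCos z.2
  have h := circSin_sq_add_circCos_sq z.2
  unfold den; nlinarith

theorem sinh_sq_le_den (z : Cyl) : Real.sinh z.1 ^ 2 ≤ den z * (den z + 2) := by
  have h1 := Real.one_le_cosh z.1
  have h2 := circCos_le_one z.2
  have h3 := neg_one_le_circCos z.2
  have h := Real.cosh_sq z.1
  have : Real.sinh z.1 ^ 2 = (Real.cosh z.1 - 1) * (Real.cosh z.1 + 1) := by linarith
  rw [this]
  have hd : den z = Real.cosh z.1 - circCos z.2 := rfl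
  apply mul_le_mul <;> linarith

/-- Factor `sinh² = (cosh - 1)(cosh + 1)` and `sin² = (1 - cos)(1 + cos)`, then pair the factors
crosswise: each pair is a constant times `den`, and `4 * 2 ≤ 3 ^ 2`. This controls the mixed
derivatives of the kernel. -/
theorem sinh_mul_circSin_sq_le (z : Cyl) :
    (Real.sinh z.1 * circSin z.2) ^ 2 ≤ (3 * den z) ^ 2 := by
  have h1 := Real.one_le_cosh z.1
  have h2 := circCos_le_one z.2
  have h3 := neg_one_le_circCos z.2
  have h := Real.cosh_sq z.1
  have h' := circSin_sq_add_circCos_sq z.2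
  have e1 : Real.sinh z.1 ^ 2 = (Real.cosh z.1 - 1) * (Real.cosh z.1 + 1) := by linarith
  have e2 : circSin z.2 ^ 2 = (1 - circCos z.2) * (1 + circCos z.2) := by linarith
  have e3 : (1 - circCos z.2) * (Real.cosh z.1 + 1) ≤ 4 * den z := by
    unfold den; nlinarith
  have e4 : (Real.cosh z.1 - 1) * (1 + circCos z.2) ≤ 2 * den z := by
    unfold den; nlinarith
  have e5 : 0 ≤ (1 - circCos z.2) * (Real.cosh z.1 + 1) := by
    apply mul_nonneg <;> linarith
  have e6 : 0 ≤ (Real.cosh z.1 - 1) * (1 + circCos z.2) := by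
    apply mul_nonneg <;> linarith
  have := mul_le_mul e3 e4 e6 (by linarith [den_nonneg z])
  rw [mul_pow, e1, e2]
  nlinarith [sq_nonneg (den z)]

/-! ### Integrals over the circle of functions of the distance to the origin -/

theorem circle_integrable_norm {f : ℝ → ℝ} (hf : Measurable f)
    (h : IntegrableOn f (Ioc 0 Real.pi)) :
    Integrable (fun y : AddCircle (2 * Real.pi) => f ‖y‖) := by
  have hm := AddCircle.measurePreserving_mk (2 * Real.pi) (-Real.pi)
  have hmeas : AEStronglyMeasurable (fun y : AddCircle (2 * Real.pi) => f ‖y‖) volume :=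
    (hf.comp measurable_norm).aestronglyMeasurable
  refine (hm.integrable_comp hmeas).1 ?_
  have e : -Real.pi + 2 * Real.pi = Real.pi := by ring
  rw [e]
  have key : IntegrableOn (fun r => f |r|) (Ioc (-Real.pi) Real.pi) := by
    have h1 : IntegrableOn (fun r => f |r|) (Ioc 0 Real.pi) :=
      h.congr_fun (fun r hr => by simp [abs_of_pos hr.1]) measurableSet_Ioc
    have h2 : IntervalIntegrable (fun r => f |r|) volume 0 Real.pi :=
      (intervalIntegrable_iff_integrableOn_Ioc_of_le Real.pi_pos.le).2 h1
    have h3 : IntervalIntegrable (fun r => f |r|) volume 0 (-Real.pi) := by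
      have := (IntervalIntegrable.iff_comp_neg (f := fun r => f |r|) (a := 0) (b := Real.pi)).1 h2
      simpa using this
    exact (intervalIntegrable_iff_integrableOn_Ioc_of_le (by linarith [Real.pi_pos])).1
      (h3.symm.trans h2)
  refine key.congr_fun (fun r hr => ?_) measurableSet_Ioc
  simp [norm_coe_of_abs_le (abs_le.2 ⟨hr.1.le, hr.2⟩)]

theorem circle_integral_norm (f : ℝ → ℝ) :
    ∫ y : AddCircle (2 * Real.pi), f ‖y‖ = ∫ r in Ioc (-Real.pi) Real.pi, f |r| := by
  rw [← AddCircle.integral_preimage (2 * Real.pi) (-Real.pi)]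
  have e : -Real.pi + 2 * Real.pi = Real.pi := by ring
  rw [e]
  refine setIntegral_congr_fun measurableSet_Ioc (fun r hr => ?_)
  simp [norm_coe_of_abs_le (abs_le.2 ⟨hr.1.le, hr.2⟩)]

theorem integrable_inv_sq_add_sq {s : ℝ} (hs : 0 < s) :
    Integrable (fun r : ℝ => (r ^ 2 + s ^ 2)⁻¹) := by
  have h := (integrable_inv_one_add_sq.comp_div hs.ne').const_mul (s ^ 2)⁻¹
  refine h.congr (Filter.Eventually.of_forall fun r => ?_)
  simp only
  rw [← mul_inv]
  congr 1
  field_simp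
  ring

theorem integral_inv_sq_add_sq {s : ℝ} (hs : 0 < s) :
    ∫ r : ℝ, (r ^ 2 + s ^ 2)⁻¹ = Real.pi / s := by
  have h : ∀ r : ℝ, (r ^ 2 + s ^ 2)⁻¹ = (s ^ 2)⁻¹ * (1 + (r / s) ^ 2)⁻¹ := by
    intro r
    rw [← mul_inv]
    congr 1
    field_simp
    ring
  simp_rw [h]
  rw [integral_const_mul, Measure.integral_comp_div (fun r : ℝ => (1 + r ^ 2)⁻¹) s,
    integral_univ_inv_one_add_sq, abs_of_pos hs, smul_eq_mul]
  field_simp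

theorem circle_integral_inv_le {s : ℝ} (hs : 0 < s) :
    ∫ y : AddCircle (2 * Real.pi), (‖y‖ ^ 2 + s ^ 2)⁻¹ ≤ Real.pi / s := by
  rw [circle_integral_norm (fun r => (r ^ 2 + s ^ 2)⁻¹), ← integral_inv_sq_add_sq hs]
  simp_rw [sq_abs]
  exact setIntegral_le_integral (integrable_inv_sq_add_sq hs)
    (Filter.Eventually.of_forall fun r => by positivity)

theorem circle_integrable_rpow {p : ℝ} (hp : -1 < p) :
    Integrable (fun y : AddCircle (2 * Real.pi) => ‖y‖ ^ p) := by
  refine circle_integrable_norm (f := fun r => r ^ p) (by fun_prop) ?_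
  exact (intervalIntegrable_iff_integrableOn_Ioc_of_le Real.pi_pos.le).1
    (intervalIntegral.intervalIntegrable_rpow' hp)

theorem integrable_inv_den_add {e : ℝ} (he : 0 < e) (he1 : e ≤ 1) :
    Integrable (fun z : Cyl => (den z + e)⁻¹) := by
  have h1 : Integrable (fun z : Cyl => (5 / e * (1 + z.1 ^ 2)⁻¹) * (1 : ℝ)) :=
    (integrable_inv_one_add_sq.const_mul (5 / e)).mul_prod (integrable_const (1 : ℝ))
  refine h1.mono' ?_ (Filter.Eventually.of_forall fun z => ?_)
  · exact ((continuous_den.measurable.add_const e).inv).aestronglyMeasurable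
  · have hd := sq_add_sq_le_den z
    have hd0 := den_nonneg z
    rw [Real.norm_of_nonneg (by positivity), mul_one, ← div_eq_mul_inv, div_div,
      inv_eq_one_div, div_le_div_iff₀ (by positivity) (by positivity)]
    nlinarith [sq_nonneg z.1, sq_nonneg ‖z.2‖, mul_nonneg he.le (sq_nonneg z.1)]

theorem integrable_indicator_inv_abs_add {b : ℝ} (hb : 0 < b) :
    Integrable (fun x : ℝ => (Iic (1 : ℝ)).indicator (fun r => (r + b)⁻¹) |x|) := by
  have h : (fun x : ℝ => (Iic (1 : ℝ)).indicator (fun r => (r + b)⁻¹) |x|)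
      = (Icc (-1 : ℝ) 1).indicator (fun x => (|x| + b)⁻¹) := by
    ext x
    simp only [indicator, mem_Iic, mem_Icc, abs_le]
  rw [h, integrable_indicator_iff measurableSet_Icc]
  refine ContinuousOn.integrableOn_compact isCompact_Icc (Continuous.continuousOn ?_)
  exact (continuous_abs.add continuous_const).inv₀ fun x => (by positivity : 0 < |x| + b).ne'

theorem integral_indicator_inv_abs_add {b : ℝ} (hb : 0 < b) :
    ∫ x : ℝ, (Iic (1 : ℝ)).indicator (fun r => (r + b)⁻¹) |x| = 2 * Real.log ((1 + b) / b) := by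
  rw [integral_comp_abs (f := (Iic (1 : ℝ)).indicator (fun r => (r + b)⁻¹)),
    setIntegral_indicator measurableSet_Iic, Ioi_inter_Iic,
    ← intervalIntegral.integral_of_le zero_le_one,
    intervalIntegral.integral_comp_add_right (fun x => x⁻¹), zero_add,
    integral_inv_of_pos hb (by positivity)]

/-- For `|x| ≤ 1` the integrand is dominated by a Cauchy density of width `s = (|x| + √e) / 2`,
because `s² ≤ (x² + e) / 2`; its integral is of order `1 / (|x| + √e)`, whose integral in `x`
produces the logarithm. For `|x| > 1` the quadratic growth of `den` suffices. -/
theorem circle_integral_inv_den_le {e : ℝ} (he : 0 < e) (x : ℝ) :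
    ∫ y : AddCircle (2 * Real.pi), (den (x, y) + e)⁻¹ ≤
      10 * Real.pi * (Iic (1 : ℝ)).indicator (fun r => (r + √e)⁻¹) |x| +
        20 * Real.pi * (1 + x ^ 2)⁻¹ := by
  have hb : 0 < √e := Real.sqrt_pos.2 he
  have hpi := Real.pi_pos
  by_cases hx : |x| ≤ 1
  · have hs : 0 < (|x| + √e) / 2 := by positivity
    have h1 : ∀ y : AddCircle (2 * Real.pi),
        (den (x, y) + e)⁻¹ ≤ 5 * (‖y‖ ^ 2 + ((|x| + √e) / 2) ^ 2)⁻¹ := by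
      intro y
      have hd := sq_add_sq_le_den (x, y)
      have hd0 := den_nonneg (x, y)
      rw [← div_eq_mul_inv, inv_eq_one_div, div_le_div_iff₀ (by positivity) (by positivity)]
      simp only at hd
      nlinarith [sq_nonneg (|x| - √e), Real.sq_sqrt he.le, sq_abs x]
    have hi : Integrable (fun y : AddCircle (2 * Real.pi) =>
        5 * (‖y‖ ^ 2 + ((|x| + √e) / 2) ^ 2)⁻¹) := by
      refine circle_integrable_norm (f := fun r => 5 * (r ^ 2 + ((|x| + √e) / 2) ^ 2)⁻¹)
        (by fun_prop) ?_
      exact ((integrable_inv_sq_add_sq hs).const_mul 5).integrableOn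
    calc ∫ y : AddCircle (2 * Real.pi), (den (x, y) + e)⁻¹
        ≤ ∫ y : AddCircle (2 * Real.pi), 5 * (‖y‖ ^ 2 + ((|x| + √e) / 2) ^ 2)⁻¹ :=
          integral_mono_of_nonneg
            (Filter.Eventually.of_forall fun y => by
              have := den_nonneg (x, y)
              simp only [Pi.zero_apply]; positivity) hi (Filter.Eventually.of_forall h1)
      _ ≤ 5 * (Real.pi / ((|x| + √e) / 2)) := by
          rw [integral_const_mul]
          exact mul_le_mul_of_nonneg_left (circle_integral_inv_le hs) (by norm_num)
      _ = 10 * Real.pi * (Iic (1 : ℝ)).indicator (fun r => (r + √e)⁻¹) |x| := by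
          rw [indicator_of_mem (by exact hx)]
          field_simp
          ring
      _ ≤ _ := by
          have : 0 ≤ 20 * Real.pi * (1 + x ^ 2)⁻¹ := by positivity
          linarith
  · rw [indicator_of_notMem (by simpa using hx), mul_zero, zero_add]
    have h1 : ∀ y : AddCircle (2 * Real.pi), (den (x, y) + e)⁻¹ ≤ 10 * (1 + x ^ 2)⁻¹ := by
      intro y
      have hd := sq_add_sq_le_den (x, y)
      have hd0 := den_nonneg (x, y)
      rw [← div_eq_mul_inv, inv_eq_one_div, div_le_div_iff₀ (by positivity) (by positivity)]
      simp only at hd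
      have : 1 ≤ x ^ 2 := by
        rw [← sq_abs]; nlinarith
      nlinarith [sq_nonneg ‖y‖]
    calc ∫ y : AddCircle (2 * Real.pi), (den (x, y) + e)⁻¹
        ≤ ∫ y : AddCircle (2 * Real.pi), 10 * (1 + x ^ 2)⁻¹ :=
          integral_mono_of_nonneg
            (Filter.Eventually.of_forall fun y => by
              have := den_nonneg (x, y)
              simp only [Pi.zero_apply]; positivity) (integrable_const _)
              (Filter.Eventually.of_forall h1)
      _ = _ := by
          simp only [integral_const, Measure.real, AddCircle.measure_univ, smul_eq_mul]
          rw [ENNReal.toReal_ofReal Real.two_pi_pos.le]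
          ring

/-- The gradients of the regularized kernels have `L¹` norms growing only logarithmically. -/
theorem exists_integral_inv_den_le :
    ∃ C : ℝ, 0 < C ∧ ∀ e : ℝ, 0 < e → e ≤ 1 →
      ∫ z : Cyl, (den z + e)⁻¹ ≤ C * (1 - Real.log e) := by
  have hpi := Real.pi_pos
  refine ⟨20 * Real.pi + 20 * Real.pi * Real.pi, by positivity, fun e he he1 => ?_⟩
  have hb : 0 < √e := Real.sqrt_pos.2 he
  have hb1 : √e ≤ 1 := Real.sqrt_le_one.2 he1
  have hi := integrable_inv_den_add he he1
  have h0 : ∫ z : Cyl, (den z + e)⁻¹ = ∫ x : ℝ, ∫ y : AddCircle (2 * Real.pi),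
      (den (x, y) + e)⁻¹ := integral_prod _ hi
  have i1 := (integrable_indicator_inv_abs_add hb).const_mul (10 * Real.pi)
  have i2 := integrable_inv_one_add_sq.const_mul (20 * Real.pi)
  have hlog : Real.log ((1 + √e) / √e) ≤ 1 - Real.log e / 2 := by
    rw [Real.log_div (by positivity) hb.ne', Real.log_sqrt he.le]
    have : Real.log (1 + √e) ≤ 1 + √e - 1 := Real.log_le_sub_one_of_pos (by positivity)
    linarith
  have hle : Real.log e ≤ 0 := Real.log_nonpos he.le he1
  calc ∫ z : Cyl, (den z + e)⁻¹
      ≤ ∫ x : ℝ, (10 * Real.pi * (Iic (1 : ℝ)).indicator (fun r => (r + √e)⁻¹) |x| +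
        20 * Real.pi * (1 + x ^ 2)⁻¹) := by
        rw [h0]
        exact integral_mono hi.integral_prod_left (i1.add i2)
          fun x => circle_integral_inv_den_le he x
    _ = 10 * Real.pi * (2 * Real.log ((1 + √e) / √e)) + 20 * Real.pi * Real.pi := by
        rw [integral_add i1 i2, integral_const_mul, integral_const_mul,
          integral_indicator_inv_abs_add hb, integral_univ_inv_one_add_sq]
    _ ≤ _ := by
        have := mul_le_mul_of_nonneg_left hlog (by positivity : 0 ≤ 20 * Real.pi)
        have h3 := mul_nonneg (by positivity : 0 ≤ 20 * Real.pi) (neg_nonneg.2 hle)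
        have h4 := mul_nonneg (by positivity : 0 ≤ 20 * Real.pi * Real.pi) (neg_nonneg.2 hle)
        nlinarith

/-! ### ### Integrability of the kernel singularity on strips -/

/-- The horizontal strip `|x| ≤ ρ`. -/
def strip (ρ : ℝ) : Set Cyl := {z | |z.1| ≤ ρ}

theorem measurableSet_strip (ρ : ℝ) : MeasurableSet (strip ρ) :=
  measurableSet_le (measurable_fst.norm) measurable_const

theorem strip_eq_prod (ρ : ℝ) : strip ρ = Icc (-ρ) ρ ×ˢ univ := by
  ext z; simp [strip, abs_le]

theorem volume_strip_lt_top (ρ : ℝ) : volume (strip ρ) < ⊤ := by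
  rw [strip_eq_prod, Measure.volume_eq_prod, Measure.prod_prod]
  exact ENNReal.mul_lt_top (by simp) (measure_lt_top _ _)

/-- By the arithmetic-geometric mean inequality `den` dominates `|x| ‖y‖ / 5`, which splits the
planar singularity into a product of two integrable ones, as `-3/4 > -1`. The axes are set aside
because `0 ^ (-3/4)` is `0` by convention, which makes the right-hand side vanish there; they are
null. -/
theorem den_rpow_le (z : Cyl) :
    den z ^ (-(3 / 4) : ℝ) ≤ 5 * (|z.1| ^ (-(3 / 4) : ℝ) * ‖z.2‖ ^ (-(3 / 4) : ℝ)) ∨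
      z.1 = 0 ∨ z.2 = 0 := by
  by_cases h1 : z.1 = 0
  · simp [h1]
  by_cases h2 : z.2 = 0
  · simp [h2]
  left
  have a1 : 0 < |z.1| := abs_pos.2 h1
  have a2 : 0 < ‖z.2‖ := norm_pos_iff.2 h2
  have hd : 5⁻¹ * (|z.1| * ‖z.2‖) ≤ den z := by
    have := sq_add_sq_le_den z
    rw [← sq_abs z.1] at this
    nlinarith [sq_nonneg (|z.1| - ‖z.2‖), mul_pos a1 a2]
  calc den z ^ (-(3 / 4) : ℝ) ≤ (5⁻¹ * (|z.1| * ‖z.2‖)) ^ (-(3 / 4) : ℝ) :=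
        Real.rpow_le_rpow_of_nonpos (by positivity) hd (by norm_num)
    _ = (5 : ℝ)⁻¹ ^ (-(3 / 4) : ℝ) * (|z.1| ^ (-(3 / 4) : ℝ) * ‖z.2‖ ^ (-(3 / 4) : ℝ)) := by
        rw [Real.mul_rpow (by norm_num) (by positivity), Real.mul_rpow a1.le a2.le]
    _ ≤ _ := by
        gcongr
        rw [Real.inv_rpow (by norm_num), ← Real.rpow_neg (by norm_num), neg_neg]
        calc (5 : ℝ) ^ (3 / 4 : ℝ) ≤ 5 ^ (1 : ℝ) :=
              Real.rpow_le_rpow_of_exponent_le (by norm_num) (by norm_num)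
          _ = 5 := Real.rpow_one 5

theorem integrableOn_strip_den_rpow (ρ : ℝ) :
    IntegrableOn (fun z : Cyl => den z ^ (-(3 / 4) : ℝ)) (strip ρ) := by
  have i1 : Integrable (fun x : ℝ => |x| ^ (-(3 / 4) : ℝ)) (volume.restrict (Icc (-ρ) ρ)) := by
    have h0 : ∀ c : ℝ, 0 ≤ c → IntervalIntegrable (fun x : ℝ => |x| ^ (-(3 / 4) : ℝ)) volume 0 c := by
      intro c hc
      have := intervalIntegral.intervalIntegrable_rpow' (a := 0) (b := c)
        (by norm_num : (-1 : ℝ) < -(3 / 4))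
      refine this.congr (fun x hx => ?_)
      rw [uIoc_of_le hc] at hx
      simp [abs_of_pos hx.1]
    rcases le_or_gt 0 ρ with hρ | hρ
    · have h2 := h0 ρ hρ
      have h3 : IntervalIntegrable (fun x : ℝ => |x| ^ (-(3 / 4) : ℝ)) volume 0 (-ρ) := by
        have := (IntervalIntegrable.iff_comp_neg
          (f := fun x : ℝ => |x| ^ (-(3 / 4) : ℝ)) (a := 0) (b := ρ)).1 h2
        simpa using this
      exact (intervalIntegrable_iff_integrableOn_Icc_of_le (by linarith)).1 (h3.symm.trans h2)
    · rw [Icc_eq_empty (by linarith)]; simp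
  have i2 := (i1.mul_prod (circle_integrable_rpow (p := -(3 / 4)) (by norm_num))).const_mul 5
  have hs : (volume : Measure Cyl).restrict (strip ρ) =
      (volume.restrict (Icc (-ρ) ρ)).prod volume := by
    rw [strip_eq_prod, Measure.volume_eq_prod, ← Measure.prod_restrict, Measure.restrict_univ]
  rw [IntegrableOn, hs]
  refine i2.mono' (continuous_den.measurable.pow_const _).aestronglyMeasurable ?_
  have n1 : ∀ᵐ z ∂((volume.restrict (Icc (-ρ) ρ)).prod
      (volume : Measure (AddCircle (2 * Real.pi)))), z.1 ≠ 0 := by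
    refine Measure.quasiMeasurePreserving_fst.ae (p := fun x : ℝ => x ≠ 0) ?_
    exact ae_restrict_of_ae (Measure.ae_ne volume 0)
  have n2 : ∀ᵐ z ∂((volume.restrict (Icc (-ρ) ρ)).prod
      (volume : Measure (AddCircle (2 * Real.pi)))), z.2 ≠ 0 := by
    refine Measure.quasiMeasurePreserving_snd.ae (p := fun y : AddCircle (2 * Real.pi) => y ≠ 0) ?_
    have : volume ({0} : Set (AddCircle (2 * Real.pi))) = 0 := by
      have := AddCircle.volume_closedBall (2 * Real.pi) (x := 0) 0
      simpa [Metric.closedBall_zero] using this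
    exact measure_eq_zero_iff_ae_notMem.1 this
  filter_upwards [n1, n2] with z h1 h2
  rw [Real.norm_of_nonneg (Real.rpow_nonneg (den_nonneg z) _)]
  rcases den_rpow_le z with h | h | h
  · exact h
  · exact absurd h h1
  · exact absurd h h2

/-! ### ### Smooth functions on the cylinder -/

/-- The covering map `ℝ² → S`. -/
noncomputable def cover (p : ℝ × ℝ) : Cyl := (p.1, (p.2 : AddCircle (2 * Real.pi)))

theorem cover_surjective : Function.Surjective cover := by
  rintro ⟨x, y⟩
  obtain ⟨r, -, rfl, -⟩ := exists_coe_eq_norm y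
  exact ⟨(x, r), rfl⟩

theorem isOpenQuotientMap_cover : IsOpenQuotientMap cover :=
  IsOpenQuotientMap.id.prodMap QuotientAddGroup.isOpenQuotientMap_mk

/-- Smoothness on the cylinder, read in the covering coordinates. -/
def SmoothCyl (f : Cyl → ℝ) : Prop := ContDiff ℝ ∞ (fun p : ℝ × ℝ => f (cover p))

theorem SmoothCyl.continuous {f : Cyl → ℝ} (hf : SmoothCyl f) : Continuous f :=
  isOpenQuotientMap_cover.isQuotientMap.continuous_iff.2 (ContDiff.continuous hf)

theorem SmoothCyl.hasFDerivAt {f : Cyl → ℝ} (hf : SmoothCyl f) (p : ℝ × ℝ) :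
    HasFDerivAt (fun p : ℝ × ℝ => f (cover p)) (fderiv ℝ (fun p : ℝ × ℝ => f (cover p)) p) p :=
  (ContDiff.differentiable hf (by simp) p).hasFDerivAt

theorem SmoothCyl.hasDerivAt_fst {f : Cyl → ℝ} (hf : SmoothCyl f) (p : ℝ × ℝ) :
    HasDerivAt (fun s : ℝ => f (s, (p.2 : AddCircle (2 * Real.pi))))
      (fderiv ℝ (fun p : ℝ × ℝ => f (cover p)) p (1, 0)) p.1 :=
  HasFDerivAt.comp_hasDerivAt (f := fun s : ℝ => (s, p.2)) p.1 (hf.hasFDerivAt p)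
    ((hasDerivAt_id p.1).prodMk (hasDerivAt_const p.1 p.2))

theorem SmoothCyl.hasDerivAt_snd {f : Cyl → ℝ} (hf : SmoothCyl f) (p : ℝ × ℝ) :
    HasDerivAt (fun h : ℝ => f (p.1, (p.2 : AddCircle (2 * Real.pi)) + h))
      (fderiv ℝ (fun p : ℝ × ℝ => f (cover p)) p (0, 1)) 0 := by
  have h0 : HasFDerivAt (fun p : ℝ × ℝ => f (cover p))
      (fderiv ℝ (fun p : ℝ × ℝ => f (cover p)) p) (p.1, p.2 + 0) := by
    simpa using hf.hasFDerivAt p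
  have h := h0.comp_hasDerivAt (0 : ℝ)
    ((hasDerivAt_const (0 : ℝ) p.1).prodMk ((hasDerivAt_id (0 : ℝ)).const_add p.2))
  exact h

theorem SmoothCyl.dx_cover {f : Cyl → ℝ} (hf : SmoothCyl f) (p : ℝ × ℝ) :
    dx f (cover p) = fderiv ℝ (fun p : ℝ × ℝ => f (cover p)) p (1, 0) :=
  (hf.hasDerivAt_fst p).deriv

theorem SmoothCyl.dy_cover {f : Cyl → ℝ} (hf : SmoothCyl f) (p : ℝ × ℝ) :
    dy f (cover p) = fderiv ℝ (fun p : ℝ × ℝ => f (cover p)) p (0, 1) :=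
  (hf.hasDerivAt_snd p).deriv

theorem SmoothCyl.dx {f : Cyl → ℝ} (hf : SmoothCyl f) : SmoothCyl (dx f) := by
  unfold SmoothCyl
  simp_rw [hf.dx_cover]
  exact (ContDiff.fderiv_right hf (by simp)).clm_apply contDiff_const

theorem SmoothCyl.dy {f : Cyl → ℝ} (hf : SmoothCyl f) : SmoothCyl (dy f) := by
  unfold SmoothCyl
  simp_rw [hf.dy_cover]
  exact (ContDiff.fderiv_right hf (by simp)).clm_apply contDiff_const

theorem SmoothCyl.hasDerivAt_dx {f : Cyl → ℝ} (hf : SmoothCyl f) (z : Cyl) (h : ℝ) :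
    HasDerivAt (fun s : ℝ => f (z + (s, 0))) (CylinderEuler.dx f (z + (h, 0))) h := by
  obtain ⟨p, rfl⟩ := cover_surjective z
  have e : cover p + (h, 0) = cover (p.1 + h, p.2) := by simp [cover]
  rw [e, hf.dx_cover]
  have := (hf.hasDerivAt_fst (p.1 + h, p.2)).comp_const_add p.1 h
  simpa [cover] using this

theorem SmoothCyl.hasDerivAt_dy {f : Cyl → ℝ} (hf : SmoothCyl f) (z : Cyl) (h : ℝ) :
    HasDerivAt (fun s : ℝ => f (z + (0, (s : AddCircle (2 * Real.pi)))))
      (CylinderEuler.dy f (z + (0, (h : AddCircle (2 * Real.pi))))) h := by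
  obtain ⟨p, rfl⟩ := cover_surjective z
  have e : cover p + (0, (h : AddCircle (2 * Real.pi))) = cover (p.1, p.2 + h) := by simp [cover]
  rw [e, hf.dy_cover]
  have h1 := hf.hasDerivAt_snd (p.1, p.2 + h)
  rw [← sub_self h] at h1
  have := h1.comp_sub_const h h
  simpa [cover] using this

/-! ### The regularized kernels -/

/-- The regularized kernel `- sin y / (2 (cosh x - cos y + e))`. -/
noncomputable def kr₁ (e : ℝ) (z : Cyl) : ℝ := -circSin z.2 / (2 * (den z + e))

/-- The regularized kernel `sinh x / (2 (cosh x - cos y + e))`. -/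
noncomputable def kr₂ (e : ℝ) (z : Cyl) : ℝ := Real.sinh z.1 / (2 * (den z + e))

/-- In terms of `q = D ^ (-1/4)`, the numerator bound gives a quotient of size `1 + q²`.
Regularization multiplies it by `e / (D + e) ≤ e ^ (1/4) * q`, so a power of `e` is bought with one
more power of `q`, and `q + q³` is still integrable on strips. If `D = 0` the numerator vanishes as
well. -/
theorem abs_div_den_le {n D : ℝ} (hD : 0 ≤ D) (hn : n ^ 2 ≤ D * (D + 2)) :
    |n / (2 * D)| ≤ 2 * (1 + D ^ (-(3 / 4) : ℝ)) ∧
    ∀ e : ℝ, 0 < e →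
      |n / (2 * D) - n / (2 * (D + e))| ≤ 2 * e ^ (1 / 4 : ℝ) * (1 + D ^ (-(3 / 4) : ℝ)) := by
  rcases hD.eq_or_lt with rfl | hD
  · have : n = 0 := by nlinarith
    subst this
    constructor
    · simp
    · intro e he
      simp; positivity
  have hq : 0 < D ^ (-(1 / 4) : ℝ) := Real.rpow_pos_of_pos hD _
  have q3 : D ^ (-(3 / 4) : ℝ) = (D ^ (-(1 / 4) : ℝ)) ^ 3 := by
    rw [← Real.rpow_natCast, ← Real.rpow_mul hD.le]; norm_num
  have q4 : D * (D ^ (-(1 / 4) : ℝ)) ^ 4 = 1 := by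
    rw [← Real.rpow_natCast, ← Real.rpow_mul hD.le]; norm_num
    rw [Real.rpow_neg_one, mul_inv_cancel₀ hD.ne']
  rw [q3]
  set q := D ^ (-(1 / 4) : ℝ) with hqdef
  have hn' : |n| ≤ 2 * D * (1 + q ^ 2) := by
    apply abs_le_of_sq_le_sq _ (by positivity)
    have : (2 * D * (1 + q ^ 2)) ^ 2 = 4 * D ^ 2 + 8 * D ^ 2 * q ^ 2 + 4 * D * (D * q ^ 4) := by ring
    rw [this, q4]
    have : 0 ≤ 8 * D ^ 2 * q ^ 2 := by positivity
    nlinarith [sq_nonneg D]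
  have hk : |n / (2 * D)| ≤ 1 + q ^ 2 := by
    rw [abs_div, abs_of_pos (by positivity : 0 < 2 * D), div_le_iff₀ (by positivity)]
    linarith
  constructor
  · refine hk.trans ?_
    nlinarith [mul_nonneg hq.le (sq_nonneg (q - 1)), sq_nonneg (q - 1), pow_pos hq 3]
  · intro e he
    -- A number in `[0, 1]` is at most its fourth root.
    have hfrac : e / (D + e) ≤ e ^ (1 / 4 : ℝ) * q := by
      calc e / (D + e) ≤ (e / (D + e)) ^ (1 / 4 : ℝ) :=
            Real.self_le_rpow_of_le_one (by positivity)
              ((div_le_one (by positivity)).2 (by linarith)) (by norm_num)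
        _ ≤ (e * D⁻¹) ^ (1 / 4 : ℝ) := by
            rw [← div_eq_mul_inv]
            gcongr; linarith
        _ = e ^ (1 / 4 : ℝ) * q := by
            rw [Real.mul_rpow he.le (by positivity), Real.inv_rpow hD.le, hqdef,
              Real.rpow_neg hD.le]
    have : n / (2 * D) - n / (2 * (D + e)) = n / (2 * D) * (e / (D + e)) := by
      field_simp; ring
    rw [this, abs_mul, abs_of_pos (by positivity : 0 < e / (D + e))]
    calc |n / (2 * D)| * (e / (D + e)) ≤ (1 + q ^ 2) * (e ^ (1 / 4 : ℝ) * q) :=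
          mul_le_mul hk hfrac (by positivity) (by positivity)
      _ = e ^ (1 / 4 : ℝ) * (q + q ^ 3) := by ring
      _ ≤ e ^ (1 / 4 : ℝ) * (2 * (1 + q ^ 3)) := by
          gcongr
          nlinarith [mul_nonneg hq.le (sq_nonneg (q - 1)), sq_nonneg (q - 1), pow_pos hq 3]
      _ = _ := by ring

/-- An integrable majorant of the Biot-Savart kernel on strips. -/
noncomputable def maj (z : Cyl) : ℝ := 2 * (1 + den z ^ (-(3 / 4) : ℝ))

theorem maj_nonneg (z : Cyl) : 0 ≤ maj z := by
  have := Real.rpow_nonneg (den_nonneg z) (-(3 / 4))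
  unfold maj; linarith

theorem integrableOn_maj (ρ : ℝ) : IntegrableOn maj (strip ρ) := by
  refine Integrable.const_mul ?_ 2
  exact (integrableOn_const (volume_strip_lt_top ρ).ne).add (integrableOn_strip_den_rpow ρ)

theorem neg_circSin_sq_le (z : Cyl) : (-circSin z.2) ^ 2 ≤ den z * (den z + 2) := by
  have := circSin_sq_le_den z
  have := mul_nonneg (den_nonneg z) (den_nonneg z)
  rw [neg_sq]; nlinarith

theorem abs_k₁_le (z : Cyl) : |k₁ z| ≤ maj z :=
  (abs_div_den_le (den_nonneg z) (neg_circSin_sq_le z)).1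

theorem abs_k₂_le (z : Cyl) : |k₂ z| ≤ maj z :=
  (abs_div_den_le (den_nonneg z) (sinh_sq_le_den z)).1

theorem abs_k₁_sub_kr₁_le {e : ℝ} (he : 0 < e) (z : Cyl) :
    |k₁ z - kr₁ e z| ≤ e ^ (1 / 4 : ℝ) * maj z :=
  ((abs_div_den_le (den_nonneg z) (neg_circSin_sq_le z)).2 e he).trans_eq (by unfold maj; ring)

theorem abs_k₂_sub_kr₂_le {e : ℝ} (he : 0 < e) (z : Cyl) :
    |k₂ z - kr₂ e z| ≤ e ^ (1 / 4 : ℝ) * maj z :=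
  ((abs_div_den_le (den_nonneg z) (sinh_sq_le_den z)).2 e he).trans_eq (by unfold maj; ring)

theorem measurable_k₁ : Measurable k₁ := by
  exact ((continuous_circSin.measurable.comp measurable_snd).neg).div
    (continuous_den.measurable.const_mul 2)

theorem measurable_k₂ : Measurable k₂ :=
  (Real.continuous_sinh.measurable.comp measurable_fst).div (continuous_den.measurable.const_mul 2)

theorem smoothCyl_den : SmoothCyl den :=
  (Real.contDiff_cosh.comp contDiff_fst).sub (Real.contDiff_cos.comp contDiff_snd)

theorem smoothCyl_kr₁ {e : ℝ} (he : 0 < e) : SmoothCyl (kr₁ e) := by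
  refine ContDiff.div (Real.contDiff_sin.comp contDiff_snd).neg
    (contDiff_const.mul (smoothCyl_den.add contDiff_const)) fun p => ?_
  have := den_nonneg (cover p)
  positivity

theorem smoothCyl_kr₂ {e : ℝ} (he : 0 < e) : SmoothCyl (kr₂ e) := by
  refine ContDiff.div (Real.contDiff_sinh.comp contDiff_fst)
    (contDiff_const.mul (smoothCyl_den.add contDiff_const)) fun p => ?_
  have := den_nonneg (cover p)
  positivity

theorem abs_sinh_mul_circSin_le (z : Cyl) : |Real.sinh z.1 * circSin z.2| ≤ 3 * den z :=
  abs_le_of_sq_le_sq (sinh_mul_circSin_sq_le z) (by linarith [den_nonneg z])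

/-- Each first derivative of the regularized kernels is a fraction over `2 (D + e)²` whose numerator
is `O(D + e)`; this turns the numerator bounds into the common majorant `3 / (D + e)`. -/
theorem abs_div_sq_le {n D e : ℝ} (hD : 0 ≤ D) (he : 0 < e) (hn : |n| ≤ 6 * (D + e)) :
    |n / (2 * (D + e) ^ 2)| ≤ 3 * (D + e)⁻¹ := by
  rw [abs_div, abs_of_pos (by positivity : 0 < 2 * (D + e) ^ 2), div_le_iff₀ (by positivity)]
  calc |n| ≤ 6 * (D + e) := hn
    _ = 3 * (D + e)⁻¹ * (2 * (D + e) ^ 2) := by field_simp; ring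

theorem abs_dx_kr₁_le {e : ℝ} (he : 0 < e) (z : Cyl) : |dx (kr₁ e) z| ≤ 3 * (den z + e)⁻¹ := by
  have hD := den_nonneg z
  have h1 : HasDerivAt (fun s : ℝ => den (s, z.2) + e) (Real.sinh z.1) z.1 :=
    ((Real.hasDerivAt_cosh z.1).sub_const (circCos z.2)).add_const e
  have h2 := (hasDerivAt_const z.1 (-circSin z.2)).div (h1.const_mul 2)
    (by positivity : 2 * (den z + e) ≠ 0)
  have h3 : dx (kr₁ e) z = (Real.sinh z.1 * circSin z.2) / (2 * (den z + e) ^ 2) := by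
    refine (HasDerivAt.deriv h2).trans ?_
    field_simp; ring
  rw [h3]
  exact abs_div_sq_le hD he (by linarith [abs_sinh_mul_circSin_le z])

theorem abs_dx_kr₂_le {e : ℝ} (he : 0 < e) (he1 : e ≤ 1) (z : Cyl) :
    |dx (kr₂ e) z| ≤ 3 * (den z + e)⁻¹ := by
  have hD := den_nonneg z
  have h1 : HasDerivAt (fun s : ℝ => den (s, z.2) + e) (Real.sinh z.1) z.1 :=
    ((Real.hasDerivAt_cosh z.1).sub_const (circCos z.2)).add_const e
  have h2 := (Real.hasDerivAt_sinh z.1).div (h1.const_mul 2)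
    (by positivity : 2 * (den z + e) ≠ 0)
  have h3 : dx (kr₂ e) z =
      (1 - Real.cosh z.1 * circCos z.2 + e * Real.cosh z.1) / (2 * (den z + e) ^ 2) := by
    refine (HasDerivAt.deriv h2).trans ?_
    rw [div_eq_div_iff (by positivity) (by positivity)]
    have h4 : Real.sinh z.1 * (2 * Real.sinh z.1) = 2 * (Real.cosh z.1 ^ 2 - 1) := by
      have := Real.cosh_sq z.1; linarith
    rw [h4]
    unfold den; ring
  rw [h3]
  refine abs_div_sq_le hD he ?_
  -- The term `e * cosh x` is absorbed through `e (cosh x - 1) ≤ cosh x - 1 ≤ den z`, which is where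
  -- `e ≤ 1` enters.
  have c1 := Real.one_le_cosh z.1
  have c2 := circCos_le_one z.2
  have c3 := neg_one_le_circCos z.2
  have hd : den z = Real.cosh z.1 - circCos z.2 := rfl
  rw [hd, abs_le]
  constructor <;>
    nlinarith [mul_nonneg he.le (sub_nonneg.2 c1), mul_nonneg (sub_nonneg.2 he1) (sub_nonneg.2 c1),
      mul_nonneg (sub_nonneg.2 c1) (sub_nonneg.2 c2),
      mul_nonneg (sub_nonneg.2 c1) (by linarith : 0 ≤ 1 + circCos z.2)]

theorem hasDerivAt_circSin (y : AddCircle (2 * Real.pi)) :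
    HasDerivAt (fun h : ℝ => circSin (y + h)) (circCos y) 0 := by
  obtain ⟨r, -, rfl, -⟩ := exists_coe_eq_norm y
  have h := (Real.hasDerivAt_sin (r + 0)).comp_const_add r 0
  rw [add_zero] at h
  exact h

theorem hasDerivAt_circCos (y : AddCircle (2 * Real.pi)) :
    HasDerivAt (fun h : ℝ => circCos (y + h)) (-circSin y) 0 := by
  obtain ⟨r, -, rfl, -⟩ := exists_coe_eq_norm y
  have h := (Real.hasDerivAt_cos (r + 0)).comp_const_add r 0
  rw [add_zero] at h
  exact h

theorem hasDerivAt_den_snd (z : Cyl) (e : ℝ) :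
    HasDerivAt (fun h : ℝ => den (z.1, z.2 + (h : AddCircle (2 * Real.pi))) + e)
      (circSin z.2) 0 := by
  have := ((hasDerivAt_circCos z.2).const_sub (Real.cosh z.1)).add_const e
  rwa [neg_neg] at this

theorem abs_dy_kr₁_le {e : ℝ} (he : 0 < e) (z : Cyl) : |dy (kr₁ e) z| ≤ 3 * (den z + e)⁻¹ := by
  have hD := den_nonneg z
  have h2 := (hasDerivAt_circSin z.2).neg.div ((hasDerivAt_den_snd z e).const_mul 2)
    (by simp only [AddCircle.coe_zero, add_zero]; positivity)
  have h3 : dy (kr₁ e) z =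
      (circSin z.2 ^ 2 - circCos z.2 * (den z + e)) / (2 * (den z + e) ^ 2) := by
    refine (HasDerivAt.deriv h2).trans ?_
    simp only [AddCircle.coe_zero, add_zero, Pi.neg_apply]
    field_simp; ring
  rw [h3]
  refine abs_div_sq_le hD he ?_
  have c2 := circCos_le_one z.2
  have c3 := neg_one_le_circCos z.2
  have c4 := circSin_sq_le_den z
  rw [abs_le]
  constructor <;> nlinarith [sq_nonneg (circSin z.2)]

theorem abs_dy_kr₂_le {e : ℝ} (he : 0 < e) (z : Cyl) : |dy (kr₂ e) z| ≤ 3 * (den z + e)⁻¹ := by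
  have hD := den_nonneg z
  have h2 := (hasDerivAt_const (0 : ℝ) (Real.sinh z.1)).div
    ((hasDerivAt_den_snd z e).const_mul 2)
    (by simp only [AddCircle.coe_zero, add_zero]; positivity)
  have h3 : dy (kr₂ e) z = -(Real.sinh z.1 * circSin z.2) / (2 * (den z + e) ^ 2) := by
    refine (HasDerivAt.deriv h2).trans ?_
    simp only [AddCircle.coe_zero, add_zero]
    field_simp; ring
  rw [h3]
  refine abs_div_sq_le hD he ?_
  rw [abs_neg]
  linarith [abs_sinh_mul_circSin_le z]

/-! ### ### Convolution with bounded densities supported in a strip -/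

instance isAddHaarMeasure_volume : (volume : Measure Cyl).IsAddHaarMeasure :=
  Measure.prod.instIsAddHaarMeasure volume volume

instance isNegInvariant_volume : (volume : Measure Cyl).IsNegInvariant :=
  Measure.IsAddHaarMeasure.isNegInvariant_of_regular volume

/-- Measurable functions bounded by `M` and vanishing outside the strip `|x| ≤ R`. -/
structure BddStrip (M R : ℝ) (f : Cyl → ℝ) : Prop where
  nonneg_bound : 0 ≤ M
  meas : AEStronglyMeasurable f volume
  bound : ∀ᵐ z : Cyl, |f z| ≤ M ∧ (R < |z.1| → f z = 0)

theorem BddStrip.abs_le_indicator {M R : ℝ} {f : Cyl → ℝ} (hf : BddStrip M R f) :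
    ∀ᵐ z : Cyl, |f z| ≤ (strip R).indicator (fun _ => M) z := by
  filter_upwards [hf.bound] with z hz
  by_cases h : z ∈ strip R
  · rw [indicator_of_mem h]; exact hz.1
  · rw [indicator_of_notMem h, hz.2 (not_le.1 h), abs_zero]

theorem integrable_indicator_strip (R M : ℝ) : Integrable ((strip R).indicator fun _ : Cyl => M) :=
  (integrable_indicator_iff (measurableSet_strip R)).2
    (integrableOn_const (volume_strip_lt_top R).ne)

theorem BddStrip.integrable {M R : ℝ} {f : Cyl → ℝ} (hf : BddStrip M R f) : Integrable f :=
  (integrable_indicator_strip R M).mono' hf.meas hf.abs_le_indicator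

/-- The measure of the strip `|x| ≤ R`. -/
noncomputable def stripVol (R : ℝ) : ℝ := (volume (strip R)).toReal

theorem stripVol_nonneg (R : ℝ) : 0 ≤ stripVol R := ENNReal.toReal_nonneg

theorem BddStrip.abs_integral_mul_le {M R B : ℝ} {f g : Cyl → ℝ} (hf : BddStrip M R f)
    (hg : ∀ z, |z.1| ≤ R → |g z| ≤ B) : |∫ z, f z * g z| ≤ M * stripVol R * B := by
  have h : ∫ z : Cyl, (strip R).indicator (fun _ : Cyl => M * B) z = M * stripVol R * B := by
    rw [integral_indicator (measurableSet_strip R), setIntegral_const (M * B), stripVol, Measure.real,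
      smul_eq_mul]
    ring
  rw [← h]
  rw [← Real.norm_eq_abs]
  refine norm_integral_le_of_norm_le (integrable_indicator_strip R (M * B)) ?_
  filter_upwards [hf.bound] with z hz
  rw [Real.norm_eq_abs, abs_mul]
  by_cases h : z ∈ strip R
  · rw [indicator_of_mem h]
    exact mul_le_mul hz.1 (hg z h) (abs_nonneg _) hf.nonneg_bound
  · rw [indicator_of_notMem h, hz.2 (not_le.1 h), abs_zero, zero_mul]

/-- The convolution of a kernel with a density. -/
noncomputable def cv (K f : Cyl → ℝ) (z : Cyl) : ℝ := ∫ ξ : Cyl, K (z - ξ) * f ξ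

theorem BddStrip.abs_kernel_mul_le {M R : ℝ} {f K B : Cyl → ℝ} (hf : BddStrip M R f) {z : Cyl}
    (hB0 : ∀ w, 0 ≤ B w) (hK : ∀ ξ : Cyl, |ξ.1| ≤ R → |K (z - ξ)| ≤ B (z - ξ)) :
    ∀ᵐ ξ : Cyl, ‖K (z - ξ) * f ξ‖ ≤ M * B (z - ξ) := by
  filter_upwards [hf.bound] with ξ hξ
  rw [Real.norm_eq_abs, abs_mul, mul_comm]
  rcases le_or_gt |ξ.1| R with h | h
  · exact mul_le_mul hξ.1 (hK ξ h) (abs_nonneg _) hf.nonneg_bound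
  · rw [hξ.2 h, abs_zero, zero_mul]
    exact mul_nonneg hf.nonneg_bound (hB0 _)

theorem BddStrip.abs_cv_le {M R : ℝ} {f K B : Cyl → ℝ} (hf : BddStrip M R f) {z : Cyl}
    (hB : Integrable B) (hB0 : ∀ w, 0 ≤ B w)
    (hK : ∀ ξ : Cyl, |ξ.1| ≤ R → |K (z - ξ)| ≤ B (z - ξ)) :
    |cv K f z| ≤ M * ∫ w, B w := by
  have h : ∫ ξ, M * B (z - ξ) = M * ∫ w, B w := by
    rw [integral_const_mul, integral_sub_left_eq_self B volume z]
  rw [← h]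
  exact norm_integral_le_of_norm_le ((hB.comp_sub_left z).const_mul M)
    (hf.abs_kernel_mul_le hB0 hK)

theorem BddStrip.integrable_kernel {M R : ℝ} {f K B : Cyl → ℝ} (hf : BddStrip M R f) {z : Cyl}
    (hKm : Measurable K) (hB : Integrable B) (hB0 : ∀ w, 0 ≤ B w)
    (hK : ∀ ξ : Cyl, |ξ.1| ≤ R → |K (z - ξ)| ≤ B (z - ξ)) :
    Integrable (fun ξ => K (z - ξ) * f ξ) :=
  ((hB.comp_sub_left z).const_mul M).mono'
    ((hKm.comp (measurable_const.sub measurable_id)).aestronglyMeasurable.mul hf.meas)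
    (hf.abs_kernel_mul_le hB0 hK)

/-- The majorant of the kernel restricted to a strip. -/
noncomputable def majOn (ρ : ℝ) : Cyl → ℝ := (strip ρ).indicator maj

theorem integrable_majOn (ρ : ℝ) : Integrable (majOn ρ) :=
  (integrable_indicator_iff (measurableSet_strip ρ)).2 (integrableOn_maj ρ)

theorem majOn_nonneg (ρ : ℝ) (z : Cyl) : 0 ≤ majOn ρ z :=
  indicator_nonneg (fun z _ => maj_nonneg z) z

theorem maj_sub_le_majOn {R : ℝ} {z ξ : Cyl} (hz : |z.1| ≤ R) (hξ : |ξ.1| ≤ R) :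
    maj (z - ξ) ≤ majOn (2 * R) (z - ξ) := by
  have : z - ξ ∈ strip (2 * R) := by
    have := abs_sub z.1 ξ.1
    change |z.1 - ξ.1| ≤ 2 * R
    linarith
  rw [majOn, indicator_of_mem this]

theorem u₁_eq_cv (f : Cyl → ℝ) : u₁ f = cv k₁ f := rfl

theorem u₂_eq_cv (f : Cyl → ℝ) : u₂ f = cv k₂ f := rfl

theorem BddStrip.abs_cv_le_maj {M R : ℝ} {f K : Cyl → ℝ} (hf : BddStrip M R f) {z : Cyl}
    (hz : |z.1| ≤ R) (hK : ∀ w, |K w| ≤ maj w) : |cv K f z| ≤ M * ∫ w, majOn (2 * R) w :=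
  hf.abs_cv_le (integrable_majOn _) (majOn_nonneg _)
    fun _ hξ => (hK _).trans (maj_sub_le_majOn hz hξ)

/-- For `z` and `ξ` both in the strip of half-width `R`, the difference `z - ξ` stays in the strip
of half-width `2R`, so the kernel error is only ever integrated where `maj` is integrable. -/
theorem BddStrip.abs_cv_sub_cv_le {M R c : ℝ} {f K K' : Cyl → ℝ} (hf : BddStrip M R f) {z : Cyl}
    (hz : |z.1| ≤ R) (hc : 0 ≤ c) (hKm : Measurable K) (hKm' : Measurable K')
    (hK : ∀ w, |K w| ≤ maj w) (hKK' : ∀ w, |K w - K' w| ≤ c * maj w) :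
    |cv K f z - cv K' f z| ≤ M * (c * ∫ w, majOn (2 * R) w) := by
  have hb : ∀ ξ : Cyl, |ξ.1| ≤ R → |(K - K') (z - ξ)| ≤ c * majOn (2 * R) (z - ξ) := fun ξ hξ =>
    (hKK' _).trans (mul_le_mul_of_nonneg_left (maj_sub_le_majOn hz hξ) hc)
  have hb0 : ∀ w, 0 ≤ c * majOn (2 * R) w := fun w => mul_nonneg hc (majOn_nonneg _ w)
  have i1 := hf.integrable_kernel hKm (integrable_majOn _) (majOn_nonneg _)
    (z := z) fun _ hξ => (hK _).trans (maj_sub_le_majOn hz hξ)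
  have i2 := hf.integrable_kernel (hKm.sub hKm') ((integrable_majOn (2 * R)).const_mul c) hb0 hb
  have h : cv K f z - cv K' f z = cv (K - K') f z := by
    have i3 : Integrable (fun ξ => K' (z - ξ) * f ξ) := by
      refine (i1.sub i2).congr (Filter.Eventually.of_forall fun ξ => ?_)
      simp only [Pi.sub_apply]; ring
    rw [cv, cv, ← integral_sub i1 i3, cv]
    congr 1; ext ξ
    simp only [Pi.sub_apply]; ring
  rw [h, ← integral_const_mul]
  exact hf.abs_cv_le ((integrable_majOn _).const_mul c) hb0 hb

/-- Differentiation under the integral sign. The curve `γ` stands for either coordinate direction,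
so that one argument serves both partial derivatives. -/
theorem BddStrip.hasDerivAt_cv {M R B : ℝ} {f K K' : Cyl → ℝ} (hf : BddStrip M R f)
    (hK : Continuous K) (hK' : Continuous K') (hB : ∀ w, |K' w| ≤ B) (γ : ℝ → Cyl)
    (hderiv : ∀ (w : Cyl) (h : ℝ), HasDerivAt (fun s => K (w + γ s)) (K' (w + γ h)) h)
    (hbd : ∀ z : Cyl, ∃ C, ∀ ξ : Cyl, |ξ.1| ≤ R → |K (z - ξ)| ≤ C) (z : Cyl) :
    HasDerivAt (fun s => cv K f (z + γ s)) (cv K' f (z + γ 0)) 0 := by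
  have hB0 : 0 ≤ B := (abs_nonneg _).trans (hB 0)
  have hm : ∀ (G : Cyl → ℝ), Continuous G → ∀ w : Cyl,
      AEStronglyMeasurable (fun ξ => G (w - ξ) * f ξ) volume := fun G hG w =>
    (hG.comp (continuous_const.sub continuous_id)).aestronglyMeasurable.mul hf.meas
  refine (hasDerivAt_integral_of_dominated_loc_of_deriv_le (s := univ)
    (F := fun s ξ => K (z + γ s - ξ) * f ξ) (F' := fun s ξ => K' (z + γ s - ξ) * f ξ)
    (bound := fun ξ => B * (strip R).indicator (fun _ => M) ξ) Filter.univ_mem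
    (Filter.Eventually.of_forall fun s => hm K hK _) ?_ (hm K' hK' _) ?_ ?_ ?_).2
  · obtain ⟨C, hC⟩ := hbd (z + γ 0)
    refine ((integrable_indicator_strip R M).const_mul |C|).mono' (hm K hK _) ?_
    filter_upwards [hf.bound, hf.abs_le_indicator] with ξ h1 h2
    rw [norm_mul, Real.norm_eq_abs, Real.norm_eq_abs]
    rcases le_or_gt |ξ.1| R with h | h
    · exact mul_le_mul ((hC ξ h).trans (le_abs_self C)) h2 (abs_nonneg _) (abs_nonneg _)
    · rw [h1.2 h, abs_zero, mul_zero]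
      exact mul_nonneg (abs_nonneg _) (indicator_nonneg (fun _ _ => hf.nonneg_bound) _)
  · filter_upwards [hf.abs_le_indicator] with ξ h2 s _
    rw [norm_mul, Real.norm_eq_abs, Real.norm_eq_abs]
    exact mul_le_mul (hB _) h2 (abs_nonneg _) hB0
  · exact (integrable_indicator_strip R M).const_mul B
  · filter_upwards with ξ s _
    have := (hderiv (z - ξ) s).mul_const (f ξ)
    simpa only [sub_add_eq_add_sub] using this

/-- Convolution with a smooth kernel is smooth. -/
theorem BddStrip.smoothCyl_cv {M R : ℝ} {f K : Cyl → ℝ} (hf : BddStrip M R f)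
    (hK : SmoothCyl K) : SmoothCyl (cv K f) := by
  -- A bounded measurable section of the covering map transports the density to a measure on the
  -- plane, where smoothness of convolutions is available.
  obtain ⟨sec, hsec, hsecm, hsecb⟩ : ∃ sec : Cyl → ℝ × ℝ, (∀ z, cover (sec z) = z) ∧
      Measurable sec ∧ ∀ z, (sec z).1 = z.1 ∧ |(sec z).2| ≤ Real.pi := by
    refine ⟨fun z => (z.1, (AddCircle.measurableEquivIoc (2 * Real.pi) (-Real.pi) z.2 : ℝ)),
      fun z => ?_, ?_, fun z => ⟨rfl, ?_⟩⟩
    · refine Prod.ext rfl ?_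
      exact (AddCircle.measurableEquivIoc (2 * Real.pi) (-Real.pi)).symm_apply_apply z.2
    · exact measurable_fst.prodMk (measurable_subtype_coe.comp
        ((AddCircle.measurableEquivIoc (2 * Real.pi) (-Real.pi)).measurable.comp measurable_snd))
    · have := (AddCircle.measurableEquivIoc (2 * Real.pi) (-Real.pi) z.2).2
      exact abs_le.2 ⟨this.1.le, by linarith [this.2]⟩
  have hcov : Measurable cover := isOpenQuotientMap_cover.continuous.measurable
  refine contDiff_iff_contDiffAt.2 fun p₀ => ?_
  -- The lifted kernel lacks compact support. The inner radius exceeds `‖p - sec ξ‖` for every `p`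
  -- within distance one of `p₀` and every `ξ` in the strip, so the cutoff does not change the
  -- convolution near `p₀`.
  let b : ContDiffBump (0 : ℝ × ℝ) :=
    ⟨‖p₀‖ + 1 + |R| + Real.pi + 1, ‖p₀‖ + 1 + |R| + Real.pi + 2, by
      have := Real.pi_pos; positivity, by linarith⟩
  let g : ℝ × ℝ → ℝ := fun p => b p * K (cover p)
  have hg : ContDiff ℝ ∞ g := b.contDiff.mul hK
  have hgc : HasCompactSupport g := b.hasCompactSupport.mul_right
  have hfi : LocallyIntegrable (fun p => f (cover p)) (Measure.map sec volume) := by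
    refine Integrable.locallyIntegrable ?_
    have hm : AEStronglyMeasurable (fun p => f (cover p)) (Measure.map sec volume) := by
      refine hf.meas.comp_quasiMeasurePreserving ⟨hcov, ?_⟩
      rw [Measure.map_map hcov hsecm]
      have : cover ∘ sec = id := funext hsec
      rw [this, Measure.map_id]
    rw [integrable_map_measure hm hsecm.aemeasurable]
    exact hf.integrable.congr (Filter.Eventually.of_forall fun z => by simp [hsec])
  have hconv := hgc.contDiff_convolution_right (ContinuousLinearMap.mul ℝ ℝ) hfi hg
  refine hconv.contDiffAt.congr_of_eventuallyEq ?_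
  filter_upwards [Metric.ball_mem_nhds p₀ one_pos] with p hp
  have hmg : AEStronglyMeasurable (fun t => f (cover t) * g (p - t)) (Measure.map sec volume) :=
    hfi.aestronglyMeasurable.mul
      (hg.continuous.comp (continuous_const.sub continuous_id)).aestronglyMeasurable
  have e1 : (convolution (fun p => f (cover p)) g (ContinuousLinearMap.mul ℝ ℝ)
      (Measure.map sec volume)) p = ∫ t, f (cover t) * g (p - t) ∂(Measure.map sec volume) := rfl
  rw [e1, integral_map hsecm.aemeasurable hmg]
  refine integral_congr_ae ?_
  filter_upwards [hf.bound] with ξ hξ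
  rcases le_or_gt |ξ.1| R with h | h
  · have hb : b (p - sec ξ) = 1 := by
      refine b.one_of_mem_closedBall ?_
      rw [mem_closedBall_zero_iff]
      change ‖p - sec ξ‖ ≤ ‖p₀‖ + 1 + |R| + Real.pi + 1
      have h1 : ‖p‖ ≤ ‖p₀‖ + 1 := by
        have := norm_sub_norm_le p p₀
        rw [mem_ball_iff_norm] at hp
        linarith
      have h2 : ‖sec ξ‖ ≤ |R| + Real.pi := by
        rw [Prod.norm_def, max_le_iff, Real.norm_eq_abs, Real.norm_eq_abs, (hsecb ξ).1]
        exact ⟨by linarith [le_abs_self R, Real.pi_pos],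
          by linarith [(hsecb ξ).2, abs_nonneg R]⟩
      linarith [norm_sub_le p (sec ξ)]
    have hs : cover (p - sec ξ) = cover p - ξ := by
      conv_rhs => rw [← hsec ξ]
      simp [cover]
    simp only [g]
    rw [hb, hs, hsec]; ring
  · simp only [hsec, hξ.2 h, mul_zero, zero_mul]

/-! ### ### The weak formulation for smooth test functions without compact support -/

/-- Smoothness of a function of time and of a point of the cylinder, in covering coordinates. -/
def SmoothTimeCyl (φ : ℝ → Cyl → ℝ) : Prop :=
  ContDiff ℝ ∞ (fun p : ℝ × ℝ × ℝ => φ p.1 (cover p.2))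

theorem SmoothTimeCyl.slice {φ : ℝ → Cyl → ℝ} (hφ : SmoothTimeCyl φ) (t : ℝ) :
    SmoothCyl (φ t) :=
  ContDiff.comp (f := fun p : ℝ × ℝ => (t, p)) hφ (contDiff_const.prodMk contDiff_id)

theorem SmoothTimeCyl.hasFDerivAt {φ : ℝ → Cyl → ℝ} (hφ : SmoothTimeCyl φ) (p : ℝ × ℝ × ℝ) :
    HasFDerivAt (fun p : ℝ × ℝ × ℝ => φ p.1 (cover p.2))
      (fderiv ℝ (fun p : ℝ × ℝ × ℝ => φ p.1 (cover p.2)) p) p :=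
  (ContDiff.differentiable hφ (by simp) p).hasFDerivAt

theorem SmoothTimeCyl.dt_cover {φ : ℝ → Cyl → ℝ} (hφ : SmoothTimeCyl φ) (p : ℝ × ℝ × ℝ) :
    dt φ p.1 (cover p.2) =
      fderiv ℝ (fun p : ℝ × ℝ × ℝ => φ p.1 (cover p.2)) p (1, 0) := by
  have := HasFDerivAt.comp_hasDerivAt (f := fun s : ℝ => (s, p.2)) p.1 (hφ.hasFDerivAt p)
    ((hasDerivAt_id p.1).prodMk (hasDerivAt_const p.1 p.2))
  exact this.deriv

theorem SmoothTimeCyl.dx_cover {φ : ℝ → Cyl → ℝ} (hφ : SmoothTimeCyl φ) (p : ℝ × ℝ × ℝ) :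
    dx (φ p.1) (cover p.2) =
      fderiv ℝ (fun p : ℝ × ℝ × ℝ => φ p.1 (cover p.2)) p (0, 1, 0) := by
  have := HasFDerivAt.comp_hasDerivAt (f := fun s : ℝ => (p.1, s, p.2.2)) p.2.1 (hφ.hasFDerivAt p)
    ((hasDerivAt_const p.2.1 p.1).prodMk
      ((hasDerivAt_id p.2.1).prodMk (hasDerivAt_const p.2.1 p.2.2)))
  exact this.deriv

theorem SmoothTimeCyl.dy_cover {φ : ℝ → Cyl → ℝ} (hφ : SmoothTimeCyl φ) (p : ℝ × ℝ × ℝ) :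
    dy (φ p.1) (cover p.2) =
      fderiv ℝ (fun p : ℝ × ℝ × ℝ => φ p.1 (cover p.2)) p (0, 0, 1) := by
  have h0 : HasFDerivAt (fun p : ℝ × ℝ × ℝ => φ p.1 (cover p.2))
      (fderiv ℝ (fun p : ℝ × ℝ × ℝ => φ p.1 (cover p.2)) p) (p.1, p.2.1, p.2.2 + 0) := by
    simpa using hφ.hasFDerivAt p
  have h := HasFDerivAt.comp_hasDerivAt (f := fun s : ℝ => (p.1, p.2.1, p.2.2 + s)) (0 : ℝ) h0
    ((hasDerivAt_const (0 : ℝ) p.1).prodMk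
      ((hasDerivAt_const (0 : ℝ) p.2.1).prodMk ((hasDerivAt_id (0 : ℝ)).const_add p.2.2)))
  exact h.deriv

theorem isQuotientMap_id_cover :
    IsQuotientMap (fun p : ℝ × ℝ × ℝ => ((p.1, cover p.2) : ℝ × Cyl)) :=
  (IsOpenQuotientMap.id.prodMap isOpenQuotientMap_cover).isQuotientMap

theorem SmoothTimeCyl.continuous_fderiv_apply {φ : ℝ → Cyl → ℝ} (hφ : SmoothTimeCyl φ)
    (v : ℝ × ℝ × ℝ) :
    Continuous fun p => fderiv ℝ (fun p : ℝ × ℝ × ℝ => φ p.1 (cover p.2)) p v :=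
  (ContDiff.continuous_fderiv hφ (by simp)).clm_apply continuous_const

theorem SmoothTimeCyl.continuous_dt {φ : ℝ → Cyl → ℝ} (hφ : SmoothTimeCyl φ) :
    Continuous fun p : ℝ × Cyl => dt φ p.1 p.2 :=
  isQuotientMap_id_cover.continuous_iff.2
    ((hφ.continuous_fderiv_apply (1, 0)).congr fun p => (hφ.dt_cover p).symm)

theorem SmoothTimeCyl.continuous_dx {φ : ℝ → Cyl → ℝ} (hφ : SmoothTimeCyl φ) :
    Continuous fun p : ℝ × Cyl => CylinderEuler.dx (φ p.1) p.2 :=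
  isQuotientMap_id_cover.continuous_iff.2
    ((hφ.continuous_fderiv_apply (0, 1, 0)).congr fun p => (hφ.dx_cover p).symm)

theorem SmoothTimeCyl.continuous_dy {φ : ℝ → Cyl → ℝ} (hφ : SmoothTimeCyl φ) :
    Continuous fun p : ℝ × Cyl => CylinderEuler.dy (φ p.1) p.2 :=
  isQuotientMap_id_cover.continuous_iff.2
    ((hφ.continuous_fderiv_apply (0, 0, 1)).congr fun p => (hφ.dy_cover p).symm)

/-- The space integral in the weak formulation of the Euler equation. -/
noncomputable def weakRate (θ : ℝ → Cyl → ℝ) (φ : ℝ → Cyl → ℝ) (τ : ℝ) : ℝ :=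
  ∫ z : Cyl, θ τ z * (dt φ τ z + u₁ (θ τ) z * dx (φ τ) z + u₂ (θ τ) z * dy (φ τ) z)

theorem stronglyMeasurable_cv {K : Cyl → ℝ} (hK : Measurable K) {g : ℝ × Cyl → ℝ}
    (hg : StronglyMeasurable g) :
    StronglyMeasurable fun p : ℝ × Cyl => cv K (fun ξ => g (p.1, ξ)) p.2 := by
  have h : StronglyMeasurable fun q : (ℝ × Cyl) × Cyl => K (q.1.2 - q.2) * g (q.1.1, q.2) :=
    (hK.comp ((measurable_snd.comp measurable_fst).sub measurable_snd)).stronglyMeasurable.mul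
      (hg.comp_measurable ((measurable_fst.comp measurable_fst).prodMk measurable_snd))
  exact h.integral_prod_right

theorem IsWeakSolution.exists_stronglyMeasurable {θ₀ : Cyl → ℝ} {θ : ℝ → Cyl → ℝ}
    (hθ : IsWeakSolution θ₀ θ) : ∃ g : ℝ × Cyl → ℝ, StronglyMeasurable g ∧
      ∀ᵐ τ ∂(volume.restrict (Ici (0 : ℝ))), ∀ᵐ z : Cyl, θ τ z = g (τ, z) :=
  ⟨hθ.aestronglyMeasurable_joint.mk, hθ.aestronglyMeasurable_joint.stronglyMeasurable_mk,
    Measure.ae_ae_of_ae_prod hθ.aestronglyMeasurable_joint.ae_eq_mk⟩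

/-- Replace `θ` by a jointly strongly measurable representative, whose velocities are measurable as
parametric integrals. For almost every time the change is on a null set of the cylinder and affects
neither the velocity nor the outer integral. -/
theorem IsWeakSolution.aestronglyMeasurable_weakRate {θ₀ : Cyl → ℝ} {θ : ℝ → Cyl → ℝ}
    (hθ : IsWeakSolution θ₀ θ) {φ : ℝ → Cyl → ℝ} (hφ : SmoothTimeCyl φ) :
    AEStronglyMeasurable (weakRate θ φ) (volume.restrict (Ici (0 : ℝ))) := by
  obtain ⟨g, hg, hae⟩ := hθ.exists_stronglyMeasurable
  have h : StronglyMeasurable fun p : ℝ × Cyl => g p *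
      (dt φ p.1 p.2 + cv k₁ (fun ξ => g (p.1, ξ)) p.2 * dx (φ p.1) p.2 +
        cv k₂ (fun ξ => g (p.1, ξ)) p.2 * dy (φ p.1) p.2) :=
    hg.mul ((hφ.continuous_dt.stronglyMeasurable.add
      ((stronglyMeasurable_cv measurable_k₁ hg).mul hφ.continuous_dx.stronglyMeasurable)).add
      ((stronglyMeasurable_cv measurable_k₂ hg).mul hφ.continuous_dy.stronglyMeasurable))
  refine ⟨_, h.integral_prod_right' (ν := (volume : Measure Cyl)), ?_⟩
  filter_upwards [hae] with τ hτ
  have hu : ∀ K : Cyl → ℝ, cv K (θ τ) = cv K (fun ξ => g (τ, ξ)) := fun K => by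
    ext z
    refine integral_congr_ae ?_
    filter_upwards [hτ] with ξ hξ
    rw [hξ]
  refine integral_congr_ae ?_
  filter_upwards [hτ] with z hz
  rw [u₁_eq_cv, u₂_eq_cv, hu, hu, hz]

theorem isCompact_strip (R : ℝ) : IsCompact (strip R) := by
  rw [strip_eq_prod]
  exact isCompact_Icc.prod isCompact_univ

theorem exists_bound_strip {f : ℝ × Cyl → ℝ} (hf : Continuous f) (T R : ℝ) :
    ∃ B, 0 ≤ B ∧ ∀ τ ∈ Icc 0 T, ∀ z : Cyl, |z.1| ≤ R → |f (τ, z)| ≤ B := by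
  obtain ⟨B, hB⟩ := (isCompact_Icc.prod (isCompact_strip R)).exists_bound_of_continuousOn
    (s := Icc 0 T ×ˢ strip R) hf.continuousOn
  exact ⟨|B|, abs_nonneg B, fun τ hτ z hz => (hB (τ, z) ⟨hτ, hz⟩).trans (le_abs_self B)⟩

/-- A bound for the velocity on the strip containing the support. -/
noncomputable def velBound (M R : ℝ) : ℝ := M * ∫ w, majOn (2 * R) w

theorem BddStrip.abs_u₁_le {M R : ℝ} {f : Cyl → ℝ} (hf : BddStrip M R f) {z : Cyl}
    (hz : |z.1| ≤ R) : |u₁ f z| ≤ velBound M R := hf.abs_cv_le_maj hz abs_k₁_le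

theorem BddStrip.abs_u₂_le {M R : ℝ} {f : Cyl → ℝ} (hf : BddStrip M R f) {z : Cyl}
    (hz : |z.1| ≤ R) : |u₂ f z| ≤ velBound M R := hf.abs_cv_le_maj hz abs_k₂_le

theorem BddStrip.velBound_nonneg {M R : ℝ} {f : Cyl → ℝ} (hf : BddStrip M R f) :
    0 ≤ velBound M R :=
  mul_nonneg hf.nonneg_bound (integral_nonneg (majOn_nonneg _))

theorem abs_weakRate_le {M R B₀ B₁ B₂ τ : ℝ} {θ φ : ℝ → Cyl → ℝ} (hf : BddStrip M R (θ τ))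
    (h₀ : ∀ z : Cyl, |z.1| ≤ R → |dt φ τ z| ≤ B₀) (h₁ : ∀ z : Cyl, |z.1| ≤ R → |dx (φ τ) z| ≤ B₁)
    (h₂ : ∀ z : Cyl, |z.1| ≤ R → |dy (φ τ) z| ≤ B₂) :
    |weakRate θ φ τ| ≤ M * stripVol R * (B₀ + velBound M R * B₁ + velBound M R * B₂) := by
  refine hf.abs_integral_mul_le fun z hz => ?_
  refine (abs_add_three _ _ _).trans ?_
  rw [abs_mul, abs_mul]
  gcongr
  · exact h₀ z hz
  · exact hf.velBound_nonneg
  · exact hf.abs_u₁_le hz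
  · exact h₁ z hz
  · exact hf.velBound_nonneg
  · exact hf.abs_u₂_le hz
  · exact h₂ z hz

theorem IsWeakSolution.intervalIntegrable_weakRate {θ₀ : Cyl → ℝ} {θ : ℝ → Cyl → ℝ}
    (hθ : IsWeakSolution θ₀ θ) {φ : ℝ → Cyl → ℝ} (hφ : SmoothTimeCyl φ) {T M R : ℝ}
    (hb : ∀ τ ∈ Icc 0 T, BddStrip M R (θ τ)) {s t : ℝ} (hs : 0 ≤ s) (hst : s ≤ t) (ht : t ≤ T) :
    IntervalIntegrable (weakRate θ φ) volume s t := by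
  obtain ⟨B₀, -, h₀⟩ := exists_bound_strip hφ.continuous_dt T R
  obtain ⟨B₁, -, h₁⟩ := exists_bound_strip hφ.continuous_dx T R
  obtain ⟨B₂, -, h₂⟩ := exists_bound_strip hφ.continuous_dy T R
  rw [intervalIntegrable_iff_integrableOn_Ioc_of_le hst]
  have hm : AEStronglyMeasurable (weakRate θ φ) (volume.restrict (Ioc s t)) :=
    (hθ.aestronglyMeasurable_weakRate hφ).mono_measure
      (Measure.restrict_mono (fun x hx => hs.trans hx.1.le) le_rfl)
  refine Integrable.mono' (integrable_const
    (M * stripVol R * (B₀ + velBound M R * B₁ + velBound M R * B₂))) hm ?_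
  filter_upwards [ae_restrict_mem measurableSet_Ioc] with τ hτ
  have hτ' : τ ∈ Icc 0 T := ⟨hs.trans hτ.1.le, hτ.2.trans ht⟩
  exact abs_weakRate_le (hb τ hτ') (h₀ τ hτ') (h₁ τ hτ') (h₂ τ hτ')

/-- Multiply the test function by cutoffs equal to one in a neighbourhood of `[0, T]` and of `|x| ≤
R`. There neither its values nor its derivatives change, and elsewhere in space the solution
vanishes. -/
theorem IsWeakSolution.weak_form_of_smooth {θ₀ : Cyl → ℝ} {θ : ℝ → Cyl → ℝ}
    (hθ : IsWeakSolution θ₀ θ) {φ : ℝ → Cyl → ℝ} (hφ : SmoothTimeCyl φ) {T M R : ℝ}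
    (hb : ∀ τ ∈ Icc 0 T, BddStrip M R (θ τ)) (hR : ∀ᵐ z : Cyl, R < |z.1| → θ₀ z = 0)
    {t : ℝ} (ht : t ∈ Icc 0 T) :
    ∫ z : Cyl, θ t z * φ t z = (∫ z : Cyl, θ₀ z * φ 0 z) + ∫ τ in (0 : ℝ)..t, weakRate θ φ τ := by
  let b : ContDiffBump (0 : ℝ) := ⟨|T| + 1, |T| + 2, by positivity, by linarith⟩
  let c : ContDiffBump (0 : ℝ) := ⟨|R| + 1, |R| + 2, by positivity, by linarith⟩
  have hb1 : ∀ τ ∈ Icc 0 T, ∀ᶠ s in 𝓝 τ, b s = 1 := by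
    intro τ hτ
    have : τ ∈ Metric.ball (0 : ℝ) (|T| + 1) := by
      rw [mem_ball_zero_iff, Real.norm_eq_abs, abs_of_nonneg hτ.1]
      linarith [le_abs_self T, hτ.2]
    filter_upwards [Metric.isOpen_ball.mem_nhds this] with s hs
    exact b.one_of_mem_closedBall (Metric.ball_subset_closedBall hs)
  have hc1 : ∀ x : ℝ, |x| ≤ R → ∀ᶠ s in 𝓝 x, c s = 1 := by
    intro x hx
    have : x ∈ Metric.ball (0 : ℝ) (|R| + 1) := by
      rw [mem_ball_zero_iff, Real.norm_eq_abs]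
      linarith [le_abs_self R]
    filter_upwards [Metric.isOpen_ball.mem_nhds this] with s hs
    exact c.one_of_mem_closedBall (Metric.ball_subset_closedBall hs)
  let ψ : ℝ → Cyl → ℝ := fun τ z => b τ * c z.1 * φ τ z
  have hψ : IsTestFunction ψ := by
    constructor
    · have h1 : ContDiff ℝ ∞ (fun p : ℝ × ℝ × ℝ => b p.1) := b.contDiff.comp contDiff_fst
      have h2 : ContDiff ℝ ∞ (fun p : ℝ × ℝ × ℝ => c p.2.1) :=
        c.contDiff.comp (contDiff_fst.comp contDiff_snd)
      exact (h1.mul h2).mul hφ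
    · refine HasCompactSupport.intro
        ((isCompact_closedBall (0 : ℝ) (|T| + 2)).prod (isCompact_strip (|R| + 2))) ?_
      rintro ⟨τ, z⟩ hp
      rw [mem_prod, not_and_or] at hp
      rcases hp with hp | hp
      · have : b τ = 0 := by
          refine b.zero_of_le_dist ?_
          exact (not_le.1 hp).le
        simp [ψ, this]
      · have : c z.1 = 0 := by
          refine c.zero_of_le_dist ?_
          rw [dist_zero_right]
          exact (not_le.1 hp).le
        simp [ψ, this]
  have hval : ∀ τ ∈ Icc 0 T, ∀ z : Cyl, |z.1| ≤ R → ψ τ z = φ τ z := by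
    intro τ hτ z hz
    simp [ψ, (hb1 τ hτ).self_of_nhds, (hc1 _ hz).self_of_nhds]
  have hrate : ∀ τ ∈ Icc 0 T, weakRate θ ψ τ = weakRate θ φ τ := by
    intro τ hτ
    refine integral_congr_ae ?_
    filter_upwards [(hb τ hτ).bound] with z hz
    rcases le_or_gt |z.1| R with h | h
    · have e1 : dt ψ τ z = dt φ τ z := by
        refine Filter.EventuallyEq.deriv_eq ?_
        filter_upwards [hb1 τ hτ] with s hs
        simp [ψ, hs, (hc1 _ h).self_of_nhds]
      have e2 : dx (ψ τ) z = dx (φ τ) z := by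
        refine Filter.EventuallyEq.deriv_eq ?_
        filter_upwards [hc1 _ h] with s hs
        simp [ψ, hs, (hb1 τ hτ).self_of_nhds]
      have e3 : dy (ψ τ) z = dy (φ τ) z := by
        unfold dy
        congr 1
        ext s
        simp [ψ, (hc1 _ h).self_of_nhds, (hb1 τ hτ).self_of_nhds]
      rw [e1, e2, e3]
    · rw [hz.2 h, zero_mul, zero_mul]
  have key := hθ.weak_form ψ hψ t ht.1
  have f1 : ∫ z : Cyl, θ t z * ψ t z = ∫ z : Cyl, θ t z * φ t z := by
    refine integral_congr_ae ?_
    filter_upwards [(hb t ht).bound] with z hz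
    rcases le_or_gt |z.1| R with h | h
    · rw [hval t ht z h]
    · rw [hz.2 h, zero_mul, zero_mul]
  have f2 : ∫ z : Cyl, θ₀ z * ψ 0 z = ∫ z : Cyl, θ₀ z * φ 0 z := by
    refine integral_congr_ae ?_
    filter_upwards [hR] with z hz
    rcases le_or_gt |z.1| R with h | h
    · rw [hval 0 ⟨le_rfl, ht.1.trans ht.2⟩ z h]
    · rw [hz h, zero_mul, zero_mul]
  have f3 : ∫ τ in (0 : ℝ)..t, weakRate θ ψ τ = ∫ τ in (0 : ℝ)..t, weakRate θ φ τ := by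
    refine intervalIntegral.integral_congr fun τ hτ => ?_
    rw [uIcc_of_le ht.1] at hτ
    exact hrate τ ⟨hτ.1, hτ.2.trans ht.2⟩
  rw [f1, f2] at key
  rw [key, ← f3]
  rfl

theorem IsWeakSolution.weak_form_interval {θ₀ : Cyl → ℝ} {θ : ℝ → Cyl → ℝ}
    (hθ : IsWeakSolution θ₀ θ) {φ : ℝ → Cyl → ℝ} (hφ : SmoothTimeCyl φ) {T M R : ℝ}
    (hb : ∀ τ ∈ Icc 0 T, BddStrip M R (θ τ)) (hR : ∀ᵐ z : Cyl, R < |z.1| → θ₀ z = 0)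
    {s t : ℝ} (hs : 0 ≤ s) (hst : s ≤ t) (ht : t ≤ T) :
    ∫ z : Cyl, θ t z * φ t z =
      (∫ z : Cyl, θ s z * φ s z) + ∫ τ in s..t, weakRate θ φ τ := by
  rw [hθ.weak_form_of_smooth hφ hb hR ⟨hs.trans hst, ht⟩,
    hθ.weak_form_of_smooth hφ hb hR ⟨hs, hst.trans ht⟩,
    ← intervalIntegral.integral_add_adjacent_intervals
      (hθ.intervalIntegrable_weakRate hφ hb le_rfl hs (hst.trans ht))
      (hθ.intervalIntegrable_weakRate hφ hb hs hst ht)]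
  ring

theorem dx_comp_sub (K : Cyl → ℝ) (z ξ : Cyl) :
    dx (fun ξ => K (z - ξ)) ξ = -dx K (z - ξ) :=
  deriv_comp_const_sub (fun s : ℝ => K (s, z.2 - ξ.2)) z.1 ξ.1

theorem dy_comp_sub (K : Cyl → ℝ) (z ξ : Cyl) :
    dy (fun ξ => K (z - ξ)) ξ = -dy K (z - ξ) := by
  have h := deriv_comp_neg
    (fun h : ℝ => K (z.1 - ξ.1, z.2 - ξ.2 + (h : AddCircle (2 * Real.pi)))) 0
  rw [neg_zero] at h
  unfold dy
  rw [← Prod.fst_sub, ← Prod.snd_sub] at h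
  rw [← h]
  congr 1
  ext s
  refine congrArg K (Prod.ext rfl ?_)
  simp only [Prod.snd_sub, AddCircle.coe_neg]
  abel

/-- The velocity generated by a smooth kernel is Lipschitz in time. -/
theorem IsWeakSolution.abs_cv_sub_le {θ₀ : Cyl → ℝ} {θ : ℝ → Cyl → ℝ}
    (hθ : IsWeakSolution θ₀ θ) {T M R : ℝ} (hb : ∀ τ ∈ Icc 0 T, BddStrip M R (θ τ))
    (hR : ∀ᵐ z : Cyl, R < |z.1| → θ₀ z = 0) {K : Cyl → ℝ} (hK : SmoothCyl K) {B : ℝ}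
    (h₁ : ∀ z, |dx K z| ≤ B) (h₂ : ∀ z, |dy K z| ≤ B)
    {s t : ℝ} (hs : 0 ≤ s) (hst : s ≤ t) (ht : t ≤ T) (z : Cyl) :
    |cv K (θ t) z - cv K (θ s) z| ≤
      M * stripVol R * (velBound M R * B + velBound M R * B) * (t - s) := by
  -- The convolution at `z` is the pairing of `θ` with the time-independent test function `ξ ↦ K (z
  -- - ξ)`, so its increment in time is an integral of the weak rate.
  have hφ : SmoothTimeCyl (fun _ ξ => K (z - ξ)) := by
    obtain ⟨p, rfl⟩ := cover_surjective z
    exact ContDiff.comp (f := fun q : ℝ × ℝ × ℝ => p - q.2) hK (contDiff_const.sub contDiff_snd)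
  have h := hθ.weak_form_interval hφ hb hR hs hst ht
  have e : ∀ τ, cv K (θ τ) z = ∫ ξ, θ τ ξ * K (z - ξ) := fun τ => by
    unfold cv; congr 1; ext ξ; ring
  rw [e, e, h, add_sub_cancel_left]
  have hn := intervalIntegral.norm_integral_le_of_norm_le_const (a := s) (b := t)
    (f := weakRate θ fun _ ξ => K (z - ξ))
    (C := M * stripVol R * (velBound M R * B + velBound M R * B)) fun τ hτ => by
      rw [uIoc_of_le hst] at hτ
      have := abs_weakRate_le (B₀ := 0) (B₁ := B) (B₂ := B) (φ := fun _ ξ => K (z - ξ))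
        (hb τ ⟨hs.trans hτ.1.le, hτ.2.trans ht⟩)
        (fun w _ => by simp [dt]) (fun w _ => by rw [dx_comp_sub, abs_neg]; exact h₁ _)
        (fun w _ => by rw [dy_comp_sub, abs_neg]; exact h₂ _)
      simpa using this
  rwa [abs_of_nonneg (sub_nonneg.2 hst)] at hn

/-! ### ### Approximate backward transport of test functions -/

theorem SmoothCyl.hasDerivAt_comp {g : Cyl → ℝ} (hg : SmoothCyl g) {a b : ℝ → ℝ} {a' b' s : ℝ}
    (ha : HasDerivAt a a' s) (hb : HasDerivAt b b' s) :
    HasDerivAt (fun s => g (cover (a s, b s)))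
      (a' * CylinderEuler.dx g (cover (a s, b s)) + b' * CylinderEuler.dy g (cover (a s, b s)))
      s := by
  have h := HasFDerivAt.comp_hasDerivAt (f := fun s => (a s, b s)) s (hg.hasFDerivAt (a s, b s))
    (ha.prodMk hb)
  rw [hg.dx_cover, hg.dy_cover]
  have e : ((a', b') : ℝ × ℝ) = a' • (1, 0) + b' • (0, 1) := by ext <;> simp
  rw [e, map_add, map_smul, map_smul, smul_eq_mul, smul_eq_mul] at h
  exact h

/-- The displacement of a point by the field `(v₁, v₂)` during the time `σ`. -/
noncomputable def shift (v₁ v₂ : Cyl → ℝ) (σ : ℝ) (z : Cyl) : Cyl :=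
  (z.1 + σ * v₁ z, z.2 + ((σ * v₂ z : ℝ) : AddCircle (2 * Real.pi)))

theorem shift_cover (v₁ v₂ : Cyl → ℝ) (σ : ℝ) (p : ℝ × ℝ) :
    shift v₁ v₂ σ (cover p) = cover (p.1 + σ * v₁ (cover p), p.2 + σ * v₂ (cover p)) := by
  simp [shift, cover]

section Shift

variable {g v₁ v₂ : Cyl → ℝ}

theorem smoothTimeCyl_shift (hg : SmoothCyl g) (h₁ : SmoothCyl v₁) (h₂ : SmoothCyl v₂) (t' : ℝ) :
    SmoothTimeCyl (fun τ z => g (shift v₁ v₂ (t' - τ) z)) := by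
  unfold SmoothTimeCyl
  simp_rw [shift_cover]
  have e1 : ContDiff ℝ ∞ fun p : ℝ × ℝ × ℝ => v₁ (cover p.2) :=
    ContDiff.comp (g := fun q : ℝ × ℝ => v₁ (cover q)) h₁ contDiff_snd
  have e2 : ContDiff ℝ ∞ fun p : ℝ × ℝ × ℝ => v₂ (cover p.2) :=
    ContDiff.comp (g := fun q : ℝ × ℝ => v₂ (cover q)) h₂ contDiff_snd
  have e3 : ContDiff ℝ ∞ fun p : ℝ × ℝ × ℝ => t' - p.1 := contDiff_const.sub contDiff_fst
  exact ContDiff.comp (g := fun p : ℝ × ℝ => g (cover p))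
    (f := fun p : ℝ × ℝ × ℝ => (p.2.1 + (t' - p.1) * v₁ (cover p.2),
      p.2.2 + (t' - p.1) * v₂ (cover p.2))) hg
    (((contDiff_fst.comp contDiff_snd).add (e3.mul e1)).prodMk
      ((contDiff_snd.comp contDiff_snd).add (e3.mul e2)))

/-- The displacement lasts for the remaining time `t' - τ`, so the test function equals `g` at the
final time `t'` and is moved along the frozen field before it. -/
theorem dt_shift (hg : SmoothCyl g) (v₁ v₂ : Cyl → ℝ) (t' τ : ℝ) (z : Cyl) :
    dt (fun τ z => g (shift v₁ v₂ (t' - τ) z)) τ z =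
      -(v₁ z * dx g (shift v₁ v₂ (t' - τ) z) + v₂ z * dy g (shift v₁ v₂ (t' - τ) z)) := by
  obtain ⟨p, rfl⟩ := cover_surjective z
  unfold dt
  simp_rw [shift_cover]
  have d : ∀ (x v : ℝ), HasDerivAt (fun s : ℝ => x + (t' - s) * v) (-1 * v) τ := fun x v =>
    (((hasDerivAt_id τ).const_sub t').mul_const v).const_add x
  rw [(hg.hasDerivAt_comp (d p.1 (v₁ (cover p))) (d p.2 (v₂ (cover p)))).deriv]
  ring

theorem dx_shift (hg : SmoothCyl g) (h₁ : SmoothCyl v₁) (h₂ : SmoothCyl v₂) (σ : ℝ) (z : Cyl) :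
    dx (fun z => g (shift v₁ v₂ σ z)) z =
      (1 + σ * dx v₁ z) * dx g (shift v₁ v₂ σ z) + σ * dx v₂ z * dy g (shift v₁ v₂ σ z) := by
  obtain ⟨p, rfl⟩ := cover_surjective z
  have e : ∀ s : ℝ, ((s, (cover p).2) : Cyl) = cover (s, p.2) := fun s => rfl
  have d1 := ((hasDerivAt_id p.1).add ((h₁.hasDerivAt_fst p).const_mul σ))
  have d2 := (((h₂.hasDerivAt_fst p).const_mul σ)).const_add p.2
  rw [← h₁.dx_cover] at d1
  rw [← h₂.dx_cover] at d2
  have h := hg.hasDerivAt_comp d1 d2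
  unfold dx at h ⊢
  simp_rw [e, shift_cover]
  exact h.deriv

theorem dy_shift (hg : SmoothCyl g) (h₁ : SmoothCyl v₁) (h₂ : SmoothCyl v₂) (σ : ℝ) (z : Cyl) :
    dy (fun z => g (shift v₁ v₂ σ z)) z =
      σ * dy v₁ z * dx g (shift v₁ v₂ σ z) + (1 + σ * dy v₂ z) * dy g (shift v₁ v₂ σ z) := by
  obtain ⟨p, rfl⟩ := cover_surjective z
  have e : ∀ h : ℝ, (((cover p).1, (cover p).2 + (h : AddCircle (2 * Real.pi))) : Cyl) =
      cover (p.1, p.2 + h) := fun h => by simp [cover]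
  have d1 := (((h₁.hasDerivAt_snd p).const_mul σ)).const_add p.1
  have d2 := (((hasDerivAt_id (0 : ℝ)).const_add p.2).add ((h₂.hasDerivAt_snd p).const_mul σ))
  rw [← h₁.dy_cover] at d1
  rw [← h₂.dy_cover] at d2
  have h := (hg.hasDerivAt_comp d1 d2).deriv
  have e0 : (p.1, (p.2 : AddCircle (2 * Real.pi)) + ((0 : ℝ) : AddCircle (2 * Real.pi))) =
      cover p := by simp [cover]
  simp only [Pi.add_apply, id, e0, add_zero] at h
  rw [shift_cover, ← h]
  unfold dy
  simp_rw [e, shift_cover]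
  rfl

end Shift

/-- Uniform bounds on the first derivatives of a function on the cylinder. -/
structure GradLe (f : Cyl → ℝ) (L : ℝ) : Prop where
  dx_le : ∀ z, |dx f z| ≤ L
  dy_le : ∀ z, |dy f z| ≤ L

theorem GradLe.nonneg {f : Cyl → ℝ} {L : ℝ} (h : GradLe f L) : 0 ≤ L :=
  (abs_nonneg _).trans (h.dx_le 0)

/-- The Jacobian of the displacement is the identity plus `σ` times the gradient of the field, and
each partial derivative collects two terms of size `σ L`. -/
theorem gradLe_shift {g v₁ v₂ : Cyl → ℝ} {Λ L σ : ℝ} (hg : SmoothCyl g) (h₁ : SmoothCyl v₁)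
    (h₂ : SmoothCyl v₂) (hΛ : GradLe g Λ) (hL₁ : GradLe v₁ L) (hL₂ : GradLe v₂ L) (hσ : 0 ≤ σ) :
    GradLe (fun z => g (shift v₁ v₂ σ z)) (Λ * (1 + 2 * σ * L)) := by
  have key : ∀ a b c d : ℝ, |a| ≤ L → |b| ≤ L → |c| ≤ Λ → |d| ≤ Λ →
      |(1 + σ * a) * c + σ * b * d| ≤ Λ * (1 + 2 * σ * L) := by
    intro a b c d ha hb hc hd
    have hL0 := hL₁.nonneg
    have e1 : |1 + σ * a| ≤ 1 + σ * L := by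
      refine (abs_add_le _ _).trans ?_
      rw [abs_one, abs_mul, abs_of_nonneg hσ]
      gcongr
    have e2 : |σ * b| ≤ σ * L := by
      rw [abs_mul, abs_of_nonneg hσ]
      gcongr
    calc |(1 + σ * a) * c + σ * b * d| ≤ |1 + σ * a| * |c| + |σ * b| * |d| := by
          refine (abs_add_le _ _).trans ?_
          rw [abs_mul, abs_mul]
      _ ≤ (1 + σ * L) * Λ + σ * L * Λ := by gcongr
      _ = _ := by ring
  constructor <;> intro z
  · rw [dx_shift hg h₁ h₂]
    exact key _ _ _ _ (hL₁.dx_le z) (hL₂.dx_le z) (hΛ.dx_le _) (hΛ.dy_le _)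
  · rw [dy_shift hg h₁ h₂, add_comm]
    exact key _ _ _ _ (hL₂.dy_le z) (hL₁.dy_le z) (hΛ.dy_le _) (hΛ.dx_le _)

/-- The left-hand side is `∂_τ φ + u · ∇φ` for the displaced test function `φ`. The identity part of
the Jacobian leaves only `u - v`, of size `η`; the rest carries a factor `σ ≤ δ`. -/
theorem abs_transport_defect_le {u₁ u₂ v₁ v₂ a₁ a₂ b₁ b₂ c d σ δ U L Λ η : ℝ}
    (hσ : 0 ≤ σ) (hσδ : σ ≤ δ) (hu₁ : |u₁| ≤ U) (hu₂ : |u₂| ≤ U) (h₁ : |u₁ - v₁| ≤ η)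
    (h₂ : |u₂ - v₂| ≤ η) (ha₁ : |a₁| ≤ L) (ha₂ : |a₂| ≤ L) (hb₁ : |b₁| ≤ L) (hb₂ : |b₂| ≤ L)
    (hc : |c| ≤ Λ) (hd : |d| ≤ Λ) :
    |-(v₁ * c + v₂ * d) + u₁ * ((1 + σ * a₁) * c + σ * a₂ * d) +
      u₂ * (σ * b₁ * c + (1 + σ * b₂) * d)| ≤ Λ * (2 * η + 4 * δ * U * L) := by
  have hU := (abs_nonneg _).trans hu₁
  have hL := (abs_nonneg _).trans ha₁
  have hη := (abs_nonneg _).trans h₁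
  have hΛ := (abs_nonneg _).trans hc
  have hδ := hσ.trans hσδ
  have e : -(v₁ * c + v₂ * d) + u₁ * ((1 + σ * a₁) * c + σ * a₂ * d) +
      u₂ * (σ * b₁ * c + (1 + σ * b₂) * d) =
      ((u₁ - v₁) + σ * (u₁ * a₁ + u₂ * b₁)) * c + ((u₂ - v₂) + σ * (u₁ * a₂ + u₂ * b₂)) * d := by
    ring
  have key : ∀ w a b : ℝ, |w| ≤ η → |a| ≤ L → |b| ≤ L →
      |w + σ * (u₁ * a + u₂ * b)| ≤ η + δ * (U * L + U * L) := by
    intro w a b hw ha hb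
    refine (abs_add_le _ _).trans (add_le_add hw ?_)
    rw [abs_mul, abs_of_nonneg hσ]
    refine mul_le_mul hσδ ((abs_add_le _ _).trans ?_) (abs_nonneg _) hδ
    rw [abs_mul, abs_mul]
    gcongr
  rw [e]
  calc _ ≤ |(u₁ - v₁) + σ * (u₁ * a₁ + u₂ * b₁)| * |c| +
        |(u₂ - v₂) + σ * (u₁ * a₂ + u₂ * b₂)| * |d| := by
        refine (abs_add_le _ _).trans ?_
        rw [abs_mul, abs_mul]
    _ ≤ (η + δ * (U * L + U * L)) * Λ + (η + δ * (U * L + U * L)) * Λ := by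
        have k1 := key _ a₁ b₁ h₁ ha₁ hb₁
        have k2 := key _ a₂ b₂ h₂ ha₂ hb₂
        gcongr
    _ = _ := by ring

/-- One step of the approximate backward transport of a test function. -/
theorem IsWeakSolution.integral_mul_ge_step {θ₀ : Cyl → ℝ} {θ : ℝ → Cyl → ℝ}
    (hθ : IsWeakSolution θ₀ θ) {T M R : ℝ} (hb : ∀ τ ∈ Icc 0 T, BddStrip M R (θ τ))
    (hR : ∀ᵐ z : Cyl, R < |z.1| → θ₀ z = 0) {g v₁ v₂ : Cyl → ℝ} {Λ L η s δ : ℝ}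
    (hg : SmoothCyl g) (h₁ : SmoothCyl v₁) (h₂ : SmoothCyl v₂) (hΛ : GradLe g Λ)
    (hL₁ : GradLe v₁ L) (hL₂ : GradLe v₂ L) (hs : 0 ≤ s) (hδ : 0 ≤ δ) (hsδ : s + δ ≤ T)
    (hv₁ : ∀ τ ∈ Icc s (s + δ), ∀ z : Cyl, |z.1| ≤ R → |u₁ (θ τ) z - v₁ z| ≤ η)
    (hv₂ : ∀ τ ∈ Icc s (s + δ), ∀ z : Cyl, |z.1| ≤ R → |u₂ (θ τ) z - v₂ z| ≤ η) :
    (∫ z, θ s z * g (shift v₁ v₂ δ z)) -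
      M * stripVol R * (Λ * (2 * η + 4 * δ * velBound M R * L)) * δ ≤
      ∫ z, θ (s + δ) z * g z := by
  have h := hθ.weak_form_interval (smoothTimeCyl_shift hg h₁ h₂ (s + δ)) hb hR hs
    (le_add_of_nonneg_right hδ) hsδ
  have e0 : ∀ z, shift v₁ v₂ (s + δ - (s + δ)) z = z := fun z => by
    refine Prod.ext ?_ ?_ <;> simp [shift]
  simp only [e0, add_sub_cancel_left] at h
  have hn := intervalIntegral.norm_integral_le_of_norm_le_const (a := s) (b := s + δ)
    (f := weakRate θ fun τ z => g (shift v₁ v₂ (s + δ - τ) z))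
    (C := M * stripVol R * (Λ * (2 * η + 4 * δ * velBound M R * L))) fun τ hτ => by
      rw [uIoc_of_le (le_add_of_nonneg_right hδ)] at hτ
      have hf := hb τ ⟨hs.trans hτ.1.le, hτ.2.trans hsδ⟩
      refine hf.abs_integral_mul_le fun z hz => ?_
      rw [dt_shift hg, dx_shift hg h₁ h₂, dy_shift hg h₁ h₂]
      exact abs_transport_defect_le (by linarith [hτ.2]) (by linarith [hτ.1]) (hf.abs_u₁_le hz)
        (hf.abs_u₂_le hz) (hv₁ τ ⟨hτ.1.le, hτ.2⟩ z hz) (hv₂ τ ⟨hτ.1.le, hτ.2⟩ z hz)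
        (hL₁.dx_le z) (hL₂.dx_le z) (hL₁.dy_le z) (hL₂.dy_le z) (hΛ.dx_le _) (hΛ.dy_le _)
  rw [Real.norm_eq_abs, add_sub_cancel_left, abs_of_nonneg hδ] at hn
  linarith [(abs_le.1 hn).1]

theorem exists_kernel_bound {K : Cyl → ℝ} (hK : Continuous K) (R : ℝ) (z : Cyl) :
    ∃ C, ∀ ξ : Cyl, |ξ.1| ≤ R → |K (z - ξ)| ≤ C := by
  obtain ⟨C, hC⟩ := (isCompact_strip R).exists_bound_of_continuousOn
    (f := fun ξ => K (z - ξ)) (hK.comp (continuous_const.sub continuous_id)).continuousOn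
  exact ⟨C, fun ξ hξ => hC ξ hξ⟩

/-- Two bounds on the kernel gradient play different roles: the uniform bound `B` only justifies
differentiating under the integral, while the integrable majorant `A` gives the constant. For the
regularized kernels `B` is of order `1 / e`, but the integral of `A` is only logarithmic. -/
theorem BddStrip.gradLe_cv {M R B : ℝ} {f K A : Cyl → ℝ} (hf : BddStrip M R f)
    (hK : SmoothCyl K) (hB : GradLe K B) (hA : Integrable A) (h₁ : ∀ w, |dx K w| ≤ A w)
    (h₂ : ∀ w, |dy K w| ≤ A w) : GradLe (cv K f) (M * ∫ w, A w) := by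
  have hs := hf.smoothCyl_cv hK
  have hA0 : ∀ w, 0 ≤ A w := fun w => (abs_nonneg _).trans (h₁ w)
  constructor <;> intro z
  · have e := (hf.hasDerivAt_cv hK.continuous hK.dx.continuous hB.dx_le (fun s => (s, 0))
      hK.hasDerivAt_dx (exists_kernel_bound hK.continuous R) z).unique
      (hs.hasDerivAt_dx z 0)
    have e0 : z + ((0 : ℝ), (0 : AddCircle (2 * Real.pi))) = z := add_zero z
    rw [e0] at e
    rw [← e]
    exact hf.abs_cv_le hA hA0 fun ξ _ => h₁ _
  · have e := (hf.hasDerivAt_cv hK.continuous hK.dy.continuous hB.dy_le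
      (fun s => (0, (s : AddCircle (2 * Real.pi))))
      hK.hasDerivAt_dy (exists_kernel_bound hK.continuous R) z).unique
      (hs.hasDerivAt_dy z 0)
    have e0 : z + ((0 : ℝ), ((0 : ℝ) : AddCircle (2 * Real.pi))) = z := add_zero z
    rw [e0] at e
    rw [← e]
    exact hf.abs_cv_le hA hA0 fun ξ _ => h₂ _

theorem inv_den_add_le {e : ℝ} (he : 0 < e) (w : Cyl) : 3 * (den w + e)⁻¹ ≤ 3 / e := by
  rw [div_eq_mul_inv]
  have := den_nonneg w
  gcongr
  linarith

theorem gradLe_kr₁ {e : ℝ} (he : 0 < e) : GradLe (kr₁ e) (3 / e) :=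
  ⟨fun w => (abs_dx_kr₁_le he w).trans (inv_den_add_le he w),
    fun w => (abs_dy_kr₁_le he w).trans (inv_den_add_le he w)⟩

theorem gradLe_kr₂ {e : ℝ} (he : 0 < e) (he1 : e ≤ 1) : GradLe (kr₂ e) (3 / e) :=
  ⟨fun w => (abs_dx_kr₂_le he he1 w).trans (inv_den_add_le he w),
    fun w => (abs_dy_kr₂_le he w).trans (inv_den_add_le he w)⟩

section Iterate

variable {θ₀ : Cyl → ℝ} {θ : ℝ → Cyl → ℝ} {T M R : ℝ}

/-- A Lipschitz constant for the regularized velocity. -/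
noncomputable def regLip (M e : ℝ) : ℝ := M * ∫ w : Cyl, 3 * (den w + e)⁻¹

/-- A bound for the time derivative of the regularized velocity. -/
noncomputable def regSpeed (M R e : ℝ) : ℝ :=
  M * stripVol R * (velBound M R * (3 / e) + velBound M R * (3 / e))

theorem BddStrip.regSpeed_nonneg {f : Cyl → ℝ} (hf : BddStrip M R f) {e : ℝ} (he : 0 < e) :
    0 ≤ regSpeed M R e := by
  have := hf.velBound_nonneg
  have := hf.nonneg_bound
  have := stripVol_nonneg R
  unfold regSpeed; positivity

/-- Two errors add up: regularizing the kernel costs `e ^ (1/4)`, and freezing the regularized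
velocity at time `s` costs its speed of variation times `δ`. -/
theorem IsWeakSolution.abs_velocity_sub_le (hθ : IsWeakSolution θ₀ θ)
    (hb : ∀ τ ∈ Icc 0 T, BddStrip M R (θ τ)) (hR : ∀ᵐ z : Cyl, R < |z.1| → θ₀ z = 0)
    {e : ℝ} (he : 0 < e) {k K : Cyl → ℝ} (hk : Measurable k) (hkm : ∀ w, |k w| ≤ maj w)
    (hK : SmoothCyl K) (hKB : GradLe K (3 / e))
    (hkK : ∀ w, |k w - K w| ≤ e ^ (1 / 4 : ℝ) * maj w) {s δ : ℝ} (hs : 0 ≤ s) (hsδ : s + δ ≤ T) :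
    ∀ τ ∈ Icc s (s + δ), ∀ z : Cyl, |z.1| ≤ R →
      |cv k (θ τ) z - cv K (θ s) z| ≤ e ^ (1 / 4 : ℝ) * velBound M R + regSpeed M R e * δ := by
  intro τ hτ z hz
  have hf := hb τ ⟨hs.trans hτ.1, hτ.2.trans hsδ⟩
  have h1 := hf.abs_cv_sub_cv_le hz (Real.rpow_nonneg he.le (1 / 4)) hk
    hK.continuous.measurable hkm hkK
  have h2 := hθ.abs_cv_sub_le hb hR hK hKB.dx_le hKB.dy_le hs hτ.1 (hτ.2.trans hsδ) z
  have h3 : regSpeed M R e * (τ - s) ≤ regSpeed M R e * δ :=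
    mul_le_mul_of_nonneg_left (by linarith [hτ.2]) (hf.regSpeed_nonneg he)
  have h4 := abs_sub_le (cv k (θ τ) z) (cv K (θ τ) z) (cv K (θ s) z)
  have h5 : M * (e ^ (1 / 4 : ℝ) * ∫ w, majOn (2 * R) w) = e ^ (1 / 4 : ℝ) * velBound M R := by
    unfold velBound; ring
  rw [h5] at h1
  unfold regSpeed at h3 ⊢
  linarith

/-- The error made in one step of the approximate backward transport, per unit of time and per
unit of the gradient of the test function. -/
noncomputable def stepError (M R e δ : ℝ) : ℝ :=
  M * stripVol R * (2 * (e ^ (1 / 4 : ℝ) * velBound M R + regSpeed M R e * δ) +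
    4 * δ * velBound M R * regLip M e)

theorem regLip_nonneg {e : ℝ} (hM : 0 ≤ M) (he : 0 < e) : 0 ≤ regLip M e :=
  mul_nonneg hM (integral_nonneg fun w => by
    have := den_nonneg w
    simp only [Pi.zero_apply]; positivity)

theorem BddStrip.stepError_nonneg {f : Cyl → ℝ} (hf : BddStrip M R f) {e δ : ℝ} (he : 0 < e)
    (hδ : 0 ≤ δ) : 0 ≤ stepError M R e δ := by
  have h1 := hf.regSpeed_nonneg he
  have h2 := hf.velBound_nonneg
  have h3 := hf.nonneg_bound
  have h4 := stripVol_nonneg R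
  have h5 := regLip_nonneg hf.nonneg_bound he
  unfold stepError; positivity

/-- The induction peels off the last time step: it replaces `g` by its displacement, which is again
smooth and nonnegative but has a larger gradient. Hence `g` and `Λ` are quantified after `n`. At the
initial time `s` the integral is nonnegative by hypothesis. -/
theorem IsWeakSolution.integral_mul_ge_iterate (hθ : IsWeakSolution θ₀ θ)
    (hb : ∀ τ ∈ Icc 0 T, BddStrip M R (θ τ)) (hR : ∀ᵐ z : Cyl, R < |z.1| → θ₀ z = 0)
    {e : ℝ} (he : 0 < e) (he1 : e ≤ 1) {s δ : ℝ} (hs : 0 ≤ s) (hδ : 0 ≤ δ)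
    (hpos : ∀ᵐ z, 0 ≤ θ s z) (n : ℕ) :
    ∀ (g : Cyl → ℝ) (Λ : ℝ), SmoothCyl g → (∀ z, 0 ≤ g z) → GradLe g Λ → s + n * δ ≤ T →
      -(n * δ * stepError M R e δ * (Λ * (1 + 2 * δ * regLip M e) ^ n)) ≤
        ∫ z, θ (s + n * δ) z * g z := by
  induction n with
  | zero =>
    intro g Λ _ hg0 _ _
    simp only [CharP.cast_eq_zero, zero_mul, neg_zero, add_zero]
    refine integral_nonneg_of_ae ?_
    filter_upwards [hpos] with z hz
    exact mul_nonneg hz (hg0 z)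
  | succ n ih =>
    intro g Λ hg hg0 hΛ hT
    push_cast at hT ⊢
    have hn : 0 ≤ (n : ℝ) * δ := by positivity
    have hsn : 0 ≤ s + n * δ := by positivity
    have hT' : s + n * δ + δ ≤ T := by linarith
    have hf := hb (s + n * δ) ⟨hsn, by linarith⟩
    have hM := hf.nonneg_bound
    have hL := regLip_nonneg hM he
    have hE := hf.stepError_nonneg he hδ
    have hA : Integrable fun w : Cyl => 3 * (den w + e)⁻¹ :=
      (integrable_inv_den_add he he1).const_mul 3
    have s₁ := hf.smoothCyl_cv (smoothCyl_kr₁ he)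
    have s₂ := hf.smoothCyl_cv (smoothCyl_kr₂ he)
    have g₁ := hf.gradLe_cv (smoothCyl_kr₁ he) (gradLe_kr₁ he) hA (abs_dx_kr₁_le he)
      (abs_dy_kr₁_le he)
    have g₂ := hf.gradLe_cv (smoothCyl_kr₂ he) (gradLe_kr₂ he he1) hA (abs_dx_kr₂_le he he1)
      (abs_dy_kr₂_le he)
    have step := hθ.integral_mul_ge_step hb hR hg s₁ s₂ hΛ g₁ g₂ hsn hδ hT'
      (hθ.abs_velocity_sub_le hb hR he measurable_k₁ abs_k₁_le (smoothCyl_kr₁ he) (gradLe_kr₁ he)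
        (abs_k₁_sub_kr₁_le he) hsn hT')
      (hθ.abs_velocity_sub_le hb hR he measurable_k₂ abs_k₂_le (smoothCyl_kr₂ he)
        (gradLe_kr₂ he he1) (abs_k₂_sub_kr₂_le he) hsn hT')
    have hφ : SmoothCyl (fun z => g (shift (cv (kr₁ e) (θ (s + n * δ)))
        (cv (kr₂ e) (θ (s + n * δ))) δ z)) := by
      have := (smoothTimeCyl_shift hg s₁ s₂ δ).slice 0
      simpa using this
    have hφΛ := gradLe_shift hg s₁ s₂ hΛ g₁ g₂ hδ
    have prev := ih _ _ hφ (fun z => hg0 _) hφΛ (by linarith)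
    have e1 : s + (n + 1) * δ = s + n * δ + δ := by ring
    rw [e1]
    refine le_trans ?_ step
    have e2 : M * stripVol R * (Λ * (2 * (e ^ (1 / 4 : ℝ) * velBound M R +
        regSpeed M R e * δ) + 4 * δ * velBound M R * regLip M e)) = stepError M R e δ * Λ := by
      unfold stepError; ring
    change _ ≤ _ - M * stripVol R * (Λ * (2 * (e ^ (1 / 4 : ℝ) * velBound M R +
        regSpeed M R e * δ) + 4 * δ * velBound M R * regLip M e)) * δ
    rw [e2]
    have e3 : Λ * (1 + 2 * δ * M * ∫ w : Cyl, 3 * (den w + e)⁻¹) =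
        Λ * (1 + 2 * δ * regLip M e) := by unfold regLip; ring
    have hΛ0 := hΛ.nonneg
    -- The error of the peeled step involves the original `Λ`; enlarging it by the full growth
    -- factor lets the `n + 1` errors be counted equally.
    have e4 : (1 : ℝ) ≤ (1 + 2 * δ * regLip M e) ^ (n + 1) :=
      one_le_pow₀ (by have : 0 ≤ 2 * δ * regLip M e := by positivity
                      linarith)
    have e5 : stepError M R e δ * Λ * δ * 1 ≤
        stepError M R e δ * Λ * δ * (1 + 2 * δ * regLip M e) ^ (n + 1) :=
      mul_le_mul_of_nonneg_left e4 (by positivity)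
    have e6 : Λ * (1 + 2 * δ * (M * ∫ w : Cyl, 3 * (den w + e)⁻¹)) *
        (1 + 2 * δ * regLip M e) ^ n = Λ * (1 + 2 * δ * regLip M e) ^ (n + 1) := by
      unfold regLip; ring
    rw [e6] at prev
    linarith

/-- Let the number of steps tend to infinity with `n δ = t - s`: the freezing errors disappear, the
growth factors are bounded by an exponential, and only the regularization error remains. -/
theorem IsWeakSolution.integral_mul_ge (hθ : IsWeakSolution θ₀ θ)
    (hb : ∀ τ ∈ Icc 0 T, BddStrip M R (θ τ)) (hR : ∀ᵐ z : Cyl, R < |z.1| → θ₀ z = 0)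
    {e : ℝ} (he : 0 < e) (he1 : e ≤ 1) {s t : ℝ} (hs : 0 ≤ s) (hst : s ≤ t) (ht : t ≤ T)
    (hpos : ∀ᵐ z, 0 ≤ θ s z) {g : Cyl → ℝ} {Λ : ℝ} (hg : SmoothCyl g) (hg0 : ∀ z, 0 ≤ g z)
    (hΛ : GradLe g Λ) :
    -((t - s) * (M * stripVol R * (2 * (e ^ (1 / 4 : ℝ) * velBound M R))) *
      (Λ * Real.exp (2 * regLip M e * (t - s)))) ≤ ∫ z, θ t z * g z := by
  have hf := hb s ⟨hs, hst.trans ht⟩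
  have hL := regLip_nonneg hf.nonneg_bound he
  have hΛ0 := hΛ.nonneg
  have hts := sub_nonneg.2 hst
  have lim : Filter.Tendsto (fun n : ℕ => (t - s) / n) Filter.atTop (𝓝 0) :=
    tendsto_const_div_atTop_nhds_zero_nat (t - s)
  have hc : Continuous fun δ => -((t - s) * stepError M R e δ *
      (Λ * Real.exp (2 * regLip M e * (t - s)))) := by
    unfold stepError; fun_prop
  have lim2 := (hc.tendsto 0).comp lim
  have e0 : stepError M R e 0 = M * stripVol R * (2 * (e ^ (1 / 4 : ℝ) * velBound M R)) := by
    unfold stepError; ring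
  rw [e0] at lim2
  refine le_of_tendsto lim2 ?_
  filter_upwards [Filter.eventually_ge_atTop 1] with n hn
  have hn0 : (0 : ℝ) < n := by exact_mod_cast hn
  have hδ : 0 ≤ (t - s) / n := by positivity
  have en : (n : ℝ) * ((t - s) / n) = t - s := by field_simp
  have h := hθ.integral_mul_ge_iterate hb hR he he1 hs hδ hpos n g Λ hg hg0 hΛ
    (by rw [en]; linarith)
  rw [en, add_sub_cancel] at h
  refine le_trans ?_ h
  have hexp : (1 + 2 * ((t - s) / n) * regLip M e) ^ n ≤
      Real.exp (2 * regLip M e * (t - s)) := by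
    have h1 := Real.add_one_le_exp (2 * ((t - s) / n) * regLip M e)
    calc (1 + 2 * ((t - s) / n) * regLip M e) ^ n
        ≤ Real.exp (2 * ((t - s) / n) * regLip M e) ^ n := by
          gcongr; linarith
      _ = Real.exp (2 * regLip M e * (t - s)) := by
          rw [← Real.exp_nat_mul]
          congr 1
          field_simp
  have hE := hf.stepError_nonneg he hδ
  simp only [Function.comp_apply, neg_le_neg_iff]
  gcongr

/-- Short-time propagation of nonnegativity, in weak form. -/
theorem IsWeakSolution.exists_time_integral_mul_nonneg (hθ : IsWeakSolution θ₀ θ) (hM : 0 ≤ M)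
    (hb : ∀ τ ∈ Icc 0 T, BddStrip M R (θ τ)) (hR : ∀ᵐ z : Cyl, R < |z.1| → θ₀ z = 0) :
    ∃ κ : ℝ, 0 < κ ∧ ∀ s t : ℝ, 0 ≤ s → s ≤ t → t ≤ T → t - s ≤ κ → (∀ᵐ z, 0 ≤ θ s z) →
      ∀ (g : Cyl → ℝ) (Λ : ℝ), SmoothCyl g → (∀ z, 0 ≤ g z) → GradLe g Λ →
        0 ≤ ∫ z, θ t z * g z := by
  obtain ⟨C, hC, hlog⟩ := exists_integral_inv_den_le
  -- The Lipschitz constant is at most `3 M C (1 - log e)`, so `48 M C (t - s) ≤ 1` keeps the growth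
  -- exponent `2 * regLip * (t - s)` below `(1 - log e) / 8`. The summand `1` keeps the inverse
  -- positive when `M = 0`. The loss `e ^ (-1/8)` is then beaten by the gain `e ^ (1/4)`.
  refine ⟨(48 * (M * C) + 1)⁻¹, by positivity, ?_⟩
  intro s t hs hst ht hκ hpos g Λ hg hg0 hΛ
  have hΛ0 := hΛ.nonneg
  have hts := sub_nonneg.2 hst
  have hU := (hb s ⟨hs, hst.trans ht⟩).velBound_nonneg
  have hV := stripVol_nonneg R
  have key : ∀ e : ℝ, 0 < e → e ≤ 1 →
      -((t - s) * (M * stripVol R * (2 * velBound M R)) * (Λ * Real.exp (1 / 8))) *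
        e ^ (1 / 8 : ℝ) ≤ ∫ z, θ t z * g z := by
    intro e he he1
    refine le_trans ?_ (hθ.integral_mul_ge hb hR he he1 hs hst ht hpos hg hg0 hΛ)
    have hl : 0 ≤ 1 - Real.log e := by linarith [Real.log_nonpos he.le he1]
    have h1 : 2 * regLip M e * (t - s) ≤ (1 - Real.log e) / 8 := by
      have h2 : regLip M e ≤ M * (3 * (C * (1 - Real.log e))) := by
        unfold regLip
        rw [integral_const_mul]
        gcongr
        exact hlog e he he1
      have h3 : (t - s) * (48 * (M * C) + 1) ≤ 1 := by
        rwa [← le_div_iff₀ (by positivity), one_div]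
      have h4 : (t - s) * (48 * (M * C)) ≤ 1 := by linarith
      calc 2 * regLip M e * (t - s) ≤ 2 * (M * (3 * (C * (1 - Real.log e)))) * (t - s) := by
            gcongr
        _ = (t - s) * (48 * (M * C)) * ((1 - Real.log e) / 8) := by ring
        _ ≤ 1 * ((1 - Real.log e) / 8) := by gcongr
        _ = _ := one_mul _
    have h5 : Real.exp (2 * regLip M e * (t - s)) ≤
        Real.exp (1 / 8) * e ^ (-(1 / 8) : ℝ) := by
      rw [Real.rpow_def_of_pos he, ← Real.exp_add]
      exact Real.exp_le_exp.2 (by linarith)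
    have h6 : e ^ (1 / 8 : ℝ) = e ^ (1 / 4 : ℝ) * e ^ (-(1 / 8) : ℝ) := by
      rw [← Real.rpow_add he]; norm_num
    rw [h6, neg_mul, neg_le_neg_iff]
    calc _ ≤ (t - s) * (M * stripVol R * (2 * (e ^ (1 / 4 : ℝ) * velBound M R))) *
          (Λ * (Real.exp (1 / 8) * e ^ (-(1 / 8) : ℝ))) := by gcongr
      _ = _ := by ring
  have hc : ContinuousAt (fun e : ℝ =>
      -((t - s) * (M * stripVol R * (2 * velBound M R)) * (Λ * Real.exp (1 / 8))) *
        e ^ (1 / 8 : ℝ)) 0 :=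
    continuousAt_const.mul (Real.continuousAt_rpow_const 0 (1 / 8) (Or.inr (by norm_num)))
  have lim := hc.tendsto.mono_left (nhdsWithin_le_nhds (s := Ioi 0))
  rw [Real.zero_rpow (by norm_num), mul_zero] at lim
  refine le_of_tendsto lim ?_
  filter_upwards [Ioc_mem_nhdsGT (zero_lt_one (α := ℝ))] with e he
  exact key e he.1 he.2

end Iterate

/-! ### ### From weak to almost everywhere nonnegativity -/

/-- A bounded smooth embedding of the cylinder into `ℝ³`. -/
noncomputable def embed (z : Cyl) : ℝ × ℝ × ℝ := (Real.arctan z.1, circCos z.2, circSin z.2)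

theorem continuous_embed : Continuous embed :=
  (Real.continuous_arctan.comp continuous_fst).prodMk
    ((continuous_circCos.comp continuous_snd).prodMk (continuous_circSin.comp continuous_snd))

theorem embed_injective : Function.Injective embed := by
  intro z w h
  obtain ⟨⟨x, r⟩, rfl⟩ := cover_surjective z
  obtain ⟨⟨x', r'⟩, rfl⟩ := cover_surjective w
  simp only [embed, cover, Prod.mk.injEq, circCos_coe, circSin_coe] at h
  refine Prod.ext (Real.arctan_injective h.1) ?_
  exact Real.Angle.cos_sin_inj h.2.1 h.2.2

theorem smoothCyl_comp_embed {H : ℝ × ℝ × ℝ → ℝ} (hH : ContDiff ℝ ∞ H) :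
    SmoothCyl (fun z => H (embed z)) :=
  hH.comp ((Real.contDiff_arctan.comp contDiff_fst).prodMk
    ((Real.contDiff_cos.comp contDiff_snd).prodMk (Real.contDiff_sin.comp contDiff_snd)))

/-- The embedding has bounded image and bounded first derivatives, thanks to `arctan`, so any smooth
function on the ambient space pulls back to a test function with bounded gradient. -/
theorem exists_gradLe_comp_embed {H : ℝ × ℝ × ℝ → ℝ} (hH : ContDiff ℝ ∞ H) :
    ∃ Λ, GradLe (fun z => H (embed z)) Λ := by
  obtain ⟨B, hB⟩ := (isCompact_closedBall (0 : ℝ × ℝ × ℝ) 2).exists_bound_of_continuousOn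
    (f := fderiv ℝ H) (hH.continuous_fderiv (by simp)).continuousOn
  have hmem : ∀ z, embed z ∈ Metric.closedBall (0 : ℝ × ℝ × ℝ) 2 := by
    intro z
    obtain ⟨⟨x, r⟩, rfl⟩ := cover_surjective z
    rw [mem_closedBall_zero_iff]
    simp only [embed, cover, circCos_coe, circSin_coe, Prod.norm_def, Real.norm_eq_abs]
    refine max_le ?_ (max_le ?_ ?_)
    · have := Real.pi_lt_d2
      rw [abs_le]
      constructor
      · linarith [Real.neg_pi_div_two_lt_arctan x]
      · linarith [Real.arctan_lt_pi_div_two x]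
    · linarith [Real.abs_cos_le_one r]
    · linarith [Real.abs_sin_le_one r]
  have hd : ∀ z, HasFDerivAt H (fderiv ℝ H (embed z)) (embed z) := fun z =>
    (hH.differentiable (by simp) _).hasFDerivAt
  have hbound : ∀ (z : Cyl) (v : ℝ × ℝ × ℝ), ‖v‖ ≤ 1 → |fderiv ℝ H (embed z) v| ≤ B := by
    intro z v hv
    have h1 := (fderiv ℝ H (embed z)).le_opNorm v
    have h2 := hB _ (hmem z)
    calc |fderiv ℝ H (embed z) v| ≤ ‖fderiv ℝ H (embed z)‖ * ‖v‖ := h1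
      _ ≤ ‖fderiv ℝ H (embed z)‖ * 1 := by gcongr
      _ ≤ B := by linarith
  refine ⟨B, fun z => ?_, fun z => ?_⟩
  · have h := HasFDerivAt.comp_hasDerivAt (f := fun s : ℝ => embed (s, z.2)) z.1 (hd z)
      ((Real.hasDerivAt_arctan z.1).prodMk
        ((hasDerivAt_const z.1 (circCos z.2)).prodMk (hasDerivAt_const z.1 (circSin z.2))))
    have e : dx (fun z => H (embed z)) z = _ := h.deriv
    rw [e]
    refine hbound z _ ?_
    simp only [Prod.norm_def, norm_zero, max_self]
    rw [max_eq_left (norm_nonneg _), Real.norm_of_nonneg (by positivity)]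
    exact (div_le_one (by positivity)).2 (by nlinarith [sq_nonneg z.1])
  · have hz : z.2 + ((0 : ℝ) : AddCircle (2 * Real.pi)) = z.2 := add_zero _
    have hd0 : HasFDerivAt H (fderiv ℝ H (embed z))
        (embed (z.1, z.2 + ((0 : ℝ) : AddCircle (2 * Real.pi)))) := by
      rw [hz]; exact hd z
    have h := HasFDerivAt.comp_hasDerivAt
      (f := fun s : ℝ => embed (z.1, z.2 + (s : AddCircle (2 * Real.pi)))) 0 hd0
      ((hasDerivAt_const (0 : ℝ) (Real.arctan z.1)).prodMk
        ((hasDerivAt_circCos z.2).prodMk (hasDerivAt_circSin z.2)))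
    have e : dy (fun z => H (embed z)) z = _ := h.deriv
    rw [e]
    refine hbound z _ ?_
    have h1 := circSin_sq_add_circCos_sq z.2
    simp only [Prod.norm_def, norm_zero, norm_neg, Real.norm_eq_abs]
    refine max_le zero_le_one (max_le ?_ ?_)
    · exact abs_le_one_iff_mul_self_le_one.2 (by nlinarith [sq_nonneg (circCos z.2)])
    · exact abs_le_one_iff_mul_self_le_one.2 (by nlinarith [sq_nonneg (circSin z.2)])

/-- A density with nonnegative integrals against smooth nonnegative functions is nonnegative. -/
theorem ae_nonneg_of_forall_integral_mul_nonneg {f : Cyl → ℝ} (hf : Integrable f)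
    (h : ∀ (g : Cyl → ℝ) (Λ : ℝ), SmoothCyl g → (∀ z, 0 ≤ g z) → GradLe g Λ →
      0 ≤ ∫ z, f z * g z) : ∀ᵐ z, 0 ≤ f z := by
  have hK : ∀ K : Set Cyl, IsCompact K → 0 ≤ ∫ z in K, f z := by
    intro K hK
    have hc : IsClosed (embed '' K) := (hK.image continuous_embed).isClosed
    -- The image of `K` is the zero set of a smooth `G` with values in `[0, 1]`, so the admissible
    -- functions `(1 - G) ^ n` converge pointwise on the cylinder to the indicator of `K`.
    obtain ⟨G, hGs, hG, hGr⟩ := hc.isOpen_compl.exists_contDiff_support_eq (n := ⊤)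
    have hG01 : ∀ p, 0 ≤ G p ∧ G p ≤ 1 := fun p => hGr (mem_range_self p)
    have hGK : ∀ z, G (embed z) = 0 ↔ z ∈ K := by
      intro z
      rw [← Function.notMem_support, hGs, mem_compl_iff, not_not,
        embed_injective.mem_set_image]
    let q : ℕ → Cyl → ℝ := fun n z => (1 - G (embed z)) ^ n
    have hq0 : ∀ n, 0 ≤ ∫ z, f z * q n z := by
      intro n
      have hs : ContDiff ℝ ∞ fun p => (1 - G p) ^ n := (contDiff_const.sub hG).pow n
      obtain ⟨Λ, hΛ⟩ := exists_gradLe_comp_embed hs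
      exact h (q n) Λ (smoothCyl_comp_embed hs)
        (fun z => pow_nonneg (by linarith [(hG01 (embed z)).2]) n) hΛ
    have hlim : Filter.Tendsto (fun n => ∫ z, f z * q n z) Filter.atTop
        (𝓝 (∫ z, K.indicator f z)) := by
      refine tendsto_integral_of_dominated_convergence (fun z => |f z|) ?_ hf.abs ?_ ?_
      · intro n
        exact hf.aestronglyMeasurable.mul ((continuous_const.sub
          (hG.continuous.comp continuous_embed)).pow n).aestronglyMeasurable
      · intro n
        filter_upwards with z
        rw [norm_mul, Real.norm_eq_abs, Real.norm_eq_abs]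
        refine mul_le_of_le_one_right (abs_nonneg _) ?_
        rw [abs_pow, abs_of_nonneg (by linarith [(hG01 (embed z)).2])]
        exact pow_le_one₀ (by linarith [(hG01 (embed z)).2]) (by linarith [(hG01 (embed z)).1])
      · filter_upwards with z
        by_cases hz : z ∈ K
        · rw [indicator_of_mem hz]
          simp [q, (hGK z).2 hz]
        · rw [indicator_of_notMem hz]
          have h1 : 0 < G (embed z) :=
            lt_of_le_of_ne (hG01 _).1 fun h0 => hz ((hGK z).1 h0.symm)
          have h2 := tendsto_pow_atTop_nhds_zero_of_lt_one
            (by linarith [(hG01 (embed z)).2] : 0 ≤ 1 - G (embed z)) (by linarith)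
          simpa using h2.const_mul (f z)
    rw [← integral_indicator hK.measurableSet]
    exact ge_of_tendsto' hlim hq0
  by_contra hneg
  obtain ⟨f', hf'm, hff'⟩ := hf.aestronglyMeasurable
  have hN : MeasurableSet {z | f' z < 0} := measurableSet_lt hf'm.measurable measurable_const
  have hpos : 0 < volume {z | f' z < 0} := by
    refine pos_iff_ne_zero.2 fun h0 => hneg ?_
    have := measure_eq_zero_iff_ae_notMem.1 h0
    filter_upwards [this, hff'] with z h1 h2
    rw [h2]; exact not_lt.1 h1
  -- Inner regularity: a negativity set of positive measure would contain a compact set of positive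
  -- measure, on which the integral is strictly negative.
  obtain ⟨K, hKN, hKc, hKpos⟩ := hN.exists_lt_isCompact hpos
  have hle : ∀ᵐ z ∂(volume.restrict K), f z < 0 := by
    filter_upwards [ae_restrict_mem hKc.measurableSet, ae_restrict_of_ae hff'] with z h1 h2
    rw [h2]; exact hKN h1
  have hint : ∫ z in K, -f z = 0 := by
    refine le_antisymm ?_ ?_
    · rw [integral_neg]; linarith [hK K hKc]
    · refine integral_nonneg_of_ae ?_
      filter_upwards [hle] with z hz
      simp only [Pi.zero_apply]; linarith
  have hz := (integral_eq_zero_iff_of_nonneg_ae (by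
    filter_upwards [hle] with z hz
    simp only [Pi.zero_apply, Pi.neg_apply]; linarith) hf.neg.integrableOn).1 hint
  have hfalse : ∀ᵐ z ∂(volume.restrict K), False := by
    filter_upwards [hle, hz] with z h1 h2
    simp only [Pi.zero_apply, Pi.neg_apply] at h2
    linarith
  rw [Filter.eventually_false_iff_eq_bot, ae_eq_bot, Measure.restrict_eq_zero] at hfalse
  exact hKpos.ne' hfalse

/-- Weak solutions with nonnegative initial datum stay nonnegative. -/
theorem IsWeakSolution.ae_nonneg {θ₀ : Cyl → ℝ} {θ : ℝ → Cyl → ℝ} (hθ : IsWeakSolution θ₀ θ)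
    {T M R : ℝ} (hM : 0 ≤ M) (hb : ∀ τ ∈ Icc 0 T, BddStrip M R (θ τ))
    (hR : ∀ᵐ z : Cyl, R < |z.1| → θ₀ z = 0) (h0 : ∀ᵐ z, 0 ≤ θ₀ z) :
    ∀ t ∈ Icc 0 T, ∀ᵐ z, 0 ≤ θ t z := by
  obtain ⟨κ, hκ, hstep⟩ := hθ.exists_time_integral_mul_nonneg hM hb hR
  have key : ∀ n : ℕ, ∀ t ∈ Icc 0 T, t ≤ n * κ → ∀ᵐ z, 0 ≤ θ t z := by
    intro n
    induction n with
    | zero =>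
      intro t ht htn
      have ht0 : t = 0 := le_antisymm (by simpa using htn) ht.1
      subst ht0
      -- At time zero `θ` agrees with the datum only through the weak identity, so nonnegativity is
      -- also recovered by testing.
      refine ae_nonneg_of_forall_integral_mul_nonneg (hb 0 ht).integrable fun g Λ hg hg0 _ => ?_
      have hφ : SmoothTimeCyl fun _ => g :=
        ContDiff.comp (g := fun q : ℝ × ℝ => g (cover q)) hg contDiff_snd
      have := hθ.weak_form_of_smooth hφ hb hR ht
      rw [intervalIntegral.integral_same, add_zero] at this
      rw [this]
      refine integral_nonneg_of_ae ?_
      filter_upwards [h0] with z hz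
      exact mul_nonneg hz (hg0 z)
    | succ n ih =>
      intro t ht htn
      push_cast at htn
      have hs : max 0 (t - κ) ∈ Icc 0 T :=
        ⟨le_max_left _ _, max_le (ht.1.trans ht.2) (by linarith [ht.2])⟩
      have hs1 : max 0 (t - κ) ≤ n * κ := max_le (by positivity) (by linarith)
      refine ae_nonneg_of_forall_integral_mul_nonneg (hb t ht).integrable fun g Λ hg hg0 hΛ => ?_
      exact hstep _ t hs.1 (max_le ht.1 (by linarith)) ht.2
        (by linarith [le_max_right 0 (t - κ)]) (ih _ hs hs1) g Λ hg hg0 hΛ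
  intro t ht
  obtain ⟨n, hn⟩ := exists_nat_ge (t / κ)
  exact key n t ht ((div_le_iff₀ hκ).1 hn)

/-! ### ### Decay of the horizontal kernel and the symmetrized flux -/

theorem k₁_neg (z : Cyl) : k₁ (-z) = -k₁ z := by
  unfold k₁
  rw [Prod.snd_neg, Prod.fst_neg, circSin_neg, circCos_neg, Real.cosh_neg]
  ring

theorem k₁_eq (z : Cyl) : k₁ z = -circSin z.2 / (2 * den z) := rfl

/-- Both `sin² y` and `x²` are at most `2 * den`, so `|x sin y|` is at most the denominator of `k₁`.
-/
theorem abs_k₁_mul_abs_le_one (z : Cyl) : |k₁ z| * |z.1| ≤ 1 := by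
  rcases (den_nonneg z).eq_or_lt with h | h
  · rw [k₁_eq, ← h]; simp
  · rw [k₁_eq, abs_div, abs_neg, abs_of_pos (by positivity : 0 < 2 * den z), div_mul_eq_mul_div,
      div_le_one (by positivity), ← abs_mul]
    refine abs_le_of_sq_le_sq ?_ (by positivity)
    have h1 := circSin_sq_le_den z
    have h2 := half_sq_le_den z
    rw [mul_pow, mul_pow]
    calc circSin z.2 ^ 2 * z.1 ^ 2 ≤ (2 * den z) * (2 * den z) := by
          gcongr; linarith
      _ = _ := by ring

/-- Write `cosh x - 1 = 2 sinh² (x / 2)` and bound one factor below by `x / 2`, the other by `exp (x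
/ 2) / 4`. The linear factor will cancel the weight `|x|` multiplying the kernel. -/
theorem mul_exp_le_cosh_sub_one {x : ℝ} (hx : 1 ≤ x) :
    x * Real.exp (x / 2) / 4 ≤ Real.cosh x - 1 := by
  have h2 : Real.cosh x = Real.cosh (x / 2) ^ 2 + Real.sinh (x / 2) ^ 2 := by
    rw [← Real.cosh_two_mul]; ring_nf
  have h1 := Real.cosh_sq (x / 2)
  have h3 : x / 2 ≤ Real.sinh (x / 2) := Real.self_le_sinh_iff.2 (by linarith)
  have h4 : Real.exp (x / 2) / 4 ≤ Real.sinh (x / 2) := by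
    rw [Real.sinh_eq]
    have e1 : Real.exp (-(x / 2)) * Real.exp (x / 2) = 1 := by
      rw [← Real.exp_add]; simp
    have e2 : x + 1 ≤ Real.exp (x / 2) * Real.exp (x / 2) := by
      rw [← Real.exp_add, add_halves]; exact Real.add_one_le_exp x
    have e3 := Real.exp_pos (x / 2)
    have e4 := Real.exp_pos (-(x / 2))
    have e5 : Real.exp (-(x / 2)) ≤ Real.exp (x / 2) / 2 := by
      by_contra hcon
      push Not at hcon
      nlinarith
    linarith
  have h5 := mul_le_mul h3 h4 (by positivity) (by linarith)
  nlinarith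

theorem abs_k₁_mul_abs_le_exp {z : Cyl} {b : ℝ} (hb : 1 ≤ b) (hz : b ≤ |z.1|) :
    |k₁ z| * |z.1| ≤ 2 * Real.exp (-b / 2) := by
  have hx : 1 ≤ |z.1| := hb.trans hz
  have h1 := mul_exp_le_cosh_sub_one hx
  rw [Real.cosh_abs] at h1
  have h2 : |z.1| * Real.exp (|z.1| / 2) / 4 ≤ den z := by
    have := circCos_le_one z.2
    unfold den; linarith
  have hd : 0 < den z := lt_of_lt_of_le (by positivity) h2
  have hs : |circSin z.2| ≤ 1 := by
    refine abs_le_one_iff_mul_self_le_one.2 ?_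
    nlinarith [circSin_sq_add_circCos_sq z.2, sq_nonneg (circCos z.2)]
  have h3 : Real.exp (-|z.1| / 2) ≤ Real.exp (-b / 2) := Real.exp_le_exp.2 (by linarith)
  refine le_trans ?_ (mul_le_mul_of_nonneg_left h3 zero_le_two)
  rw [k₁_eq, abs_div, abs_neg, abs_of_pos (by positivity : 0 < 2 * den z), div_mul_eq_mul_div,
    div_le_iff₀ (by positivity)]
  have e1 : Real.exp (-|z.1| / 2) * Real.exp (|z.1| / 2) = 1 := by
    rw [← Real.exp_add, ← Real.exp_zero]; congr 1; ring
  calc |circSin z.2| * |z.1| ≤ 1 * |z.1| := by gcongr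
    _ = 4 * Real.exp (-|z.1| / 2) * (|z.1| * Real.exp (|z.1| / 2) / 4) := by
        linear_combination (-|z.1|) * e1
    _ ≤ 4 * Real.exp (-|z.1| / 2) * den z := by gcongr
    _ = _ := by ring

/-- The pointwise bound behind the symmetrized estimate. -/
theorem abs_k₁_mul_sub_le {p : ℝ → ℝ} {a c : ℝ} (ha : 2 ≤ a) (hc : 0 ≤ c)
    (hp : ∀ x y, |p x - p y| ≤ c * |x - y|) (hp0 : ∀ x, |x| < a → p x = 0) (z ξ : Cyl) :
    |k₁ (z - ξ) * (p z.1 - p ξ.1)| ≤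
      c * ({w : Cyl | a / 2 < |w.1|}.indicator 1 z * {w : Cyl | a / 2 < |w.1|}.indicator 1 ξ +
        2 * Real.exp (-a / 4) * ({w : Cyl | a / 2 < |w.1|}.indicator 1 z +
          {w : Cyl | a / 2 < |w.1|}.indicator 1 ξ)) := by
  have hI : ∀ w : Cyl, (0 : ℝ) ≤ {w : Cyl | a / 2 < |w.1|}.indicator 1 w := fun w =>
    indicator_nonneg (fun _ _ => zero_le_one) w
  have hexp := Real.exp_pos (-a / 4)
  have hbase : |k₁ (z - ξ) * (p z.1 - p ξ.1)| ≤ c * (|k₁ (z - ξ)| * |(z - ξ).1|) := by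
    rw [abs_mul]
    calc _ ≤ |k₁ (z - ξ)| * (c * |z.1 - ξ.1|) := by gcongr; exact hp _ _
      _ = _ := by rw [Prod.fst_sub]; ring
  have hfar : a / 2 ≤ |(z - ξ).1| →
      |k₁ (z - ξ) * (p z.1 - p ξ.1)| ≤ c * (2 * Real.exp (-a / 4) * 1) := by
    intro h
    have := abs_k₁_mul_abs_le_exp (by linarith : 1 ≤ a / 2) h
    refine hbase.trans (mul_le_mul_of_nonneg_left (this.trans_eq ?_) hc)
    rw [mul_one]; congr 2; ring
  have htri := abs_sub_abs_le_abs_sub z.1 ξ.1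
  have htri' := abs_sub_abs_le_abs_sub ξ.1 z.1
  rw [abs_sub_comm ξ.1 z.1] at htri'
  by_cases hz : a / 2 < |z.1| <;> by_cases hξ : a / 2 < |ξ.1|
  · refine hbase.trans (mul_le_mul_of_nonneg_left ((abs_k₁_mul_abs_le_one _).trans ?_) hc)
    rw [indicator_of_mem (by exact hz), indicator_of_mem (by exact hξ)]
    simp only [Pi.one_apply]
    linarith
  -- The inner point contributes `p = 0`, and so does the outer one unless `|x| ≥ a`; in that case
  -- the points are at least `a / 2` apart and the kernel is exponentially small.
  · rw [indicator_of_mem (by exact hz), indicator_of_notMem (by exact hξ)]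
    simp only [Pi.one_apply, mul_zero, zero_add, add_zero]
    have e1 : p ξ.1 = 0 := hp0 _ (by linarith)
    rcases lt_or_ge |z.1| a with h | h
    · rw [hp0 _ h, e1, sub_zero, mul_zero, abs_zero]; positivity
    · exact hfar (by rw [Prod.fst_sub]; linarith)
  · rw [indicator_of_notMem (by exact hz), indicator_of_mem (by exact hξ)]
    simp only [Pi.one_apply, zero_mul, zero_add]
    have e1 : p z.1 = 0 := hp0 _ (by linarith)
    rcases lt_or_ge |ξ.1| a with h | h
    · rw [hp0 _ h, e1, sub_zero, mul_zero, abs_zero]; positivity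
    · exact hfar (by rw [Prod.fst_sub]; linarith)
  · rw [hp0 z.1 (by linarith), hp0 ξ.1 (by linarith), sub_zero, mul_zero, abs_zero]
    have := hI z
    have := hI ξ
    positivity

theorem measurableSet_outer (r : ℝ) : MeasurableSet {z : Cyl | r < |z.1|} :=
  measurableSet_lt measurable_const measurable_fst.norm

theorem outerMass_eq_integral_indicator (f : Cyl → ℝ) (r : ℝ) :
    outerMass f r = ∫ z, {z : Cyl | r < |z.1|}.indicator 1 z * f z := by
  rw [outerMass, ← integral_indicator (measurableSet_outer r)]
  congr 1; ext z
  by_cases h : z ∈ {z : Cyl | r < |z.1|}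
  · rw [indicator_of_mem h, indicator_of_mem h, Pi.one_apply, one_mul]
  · rw [indicator_of_notMem h, indicator_of_notMem h, zero_mul]

/-- The flux through a horizontal cutoff, estimated by symmetrization in the two variables. -/
theorem BddStrip.abs_integral_flux_le {M R : ℝ} {f : Cyl → ℝ} (hf : BddStrip M R f)
    (hpos : ∀ᵐ z, 0 ≤ f z) {p : ℝ → ℝ} {a c : ℝ} (ha : 2 ≤ a) (hc : 0 ≤ c) (hpc : Continuous p)
    (hp : ∀ x y, |p x - p y| ≤ c * |x - y|) (hp0 : ∀ x, |x| < a → p x = 0) :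
    |∫ z, f z * (u₁ f z * p z.1)| ≤
      c * (outerMass f (a / 2) ^ 2 +
        4 * Real.exp (-a / 4) * ((∫ z, f z) * outerMass f (a / 2))) / 2 := by
  obtain ⟨P, hP⟩ := (isCompact_strip R).exists_bound_of_continuousOn
    (f := fun z : Cyl => p z.1) (hpc.comp continuous_fst).continuousOn
  let F : Cyl × Cyl → ℝ := fun q => f q.1 * p q.1.1 * (k₁ (q.1 - q.2) * f q.2)
  have hb1 : ∀ᵐ q : Cyl × Cyl, |f q.1| ≤ M ∧ (R < |q.1.1| → f q.1 = 0) :=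
    Measure.quasiMeasurePreserving_fst.ae hf.bound
  have hb2 : ∀ᵐ q : Cyl × Cyl, |f q.2| ≤ M ∧ (R < |q.2.1| → f q.2 = 0) :=
    Measure.quasiMeasurePreserving_snd.ae hf.bound
  have hp1 : ∀ᵐ q : Cyl × Cyl, 0 ≤ f q.1 := Measure.quasiMeasurePreserving_fst.ae hpos
  have hp2 : ∀ᵐ q : Cyl × Cyl, 0 ≤ f q.2 := Measure.quasiMeasurePreserving_snd.ae hpos
  -- Absolute convergence of the double integral, needed to exchange the variables: the kernel is
  -- dominated by an integrable function of `q.1 - q.2`.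
  have hF : Integrable F := by
    have hD := (integrable_indicator_strip R M).convolution_integrand
      (ContinuousLinearMap.mul ℝ ℝ) (integrable_majOn (2 * R))
    refine (hD.const_mul (M * |P|)).mono' ?_ ?_
    · exact (hf.meas.comp_fst.mul (hpc.comp
        (continuous_fst.comp continuous_fst)).aestronglyMeasurable).mul
        ((measurable_k₁.comp (measurable_fst.sub measurable_snd)).aestronglyMeasurable.mul
          hf.meas.comp_snd)
    · filter_upwards [hb1, hb2] with q h1 h2
      have hnn : 0 ≤ M * |P| * ((strip R).indicator (fun _ => M) q.2 * majOn (2 * R) (q.1 - q.2)) :=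
        mul_nonneg (mul_nonneg hf.nonneg_bound (abs_nonneg _))
          (mul_nonneg (indicator_nonneg (fun _ _ => hf.nonneg_bound) _) (majOn_nonneg _ _))
      rcases le_or_gt |q.1.1| R with r1 | r1
      · rcases le_or_gt |q.2.1| R with r2 | r2
        · have e : (strip R).indicator (fun _ => M) q.2 = M := indicator_of_mem (by exact r2) _
          have e2 := (abs_k₁_le (q.1 - q.2)).trans (maj_sub_le_majOn r1 r2)
          have e3 : |p q.1.1| ≤ |P| := (hP q.1 r1).trans (le_abs_self P)
          have hM := hf.nonneg_bound
          have hm := majOn_nonneg (2 * R) (q.1 - q.2)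
          simp only [F, ContinuousLinearMap.mul_apply', e, Real.norm_eq_abs, abs_mul]
          calc |f q.1| * |p q.1.1| * (|k₁ (q.1 - q.2)| * |f q.2|)
              ≤ M * |P| * (majOn (2 * R) (q.1 - q.2) * M) := by
                gcongr
                · exact h1.1
                · exact h2.1
            _ = _ := by ring
        · simp only [F, h2.2 r2, mul_zero, norm_zero]; exact hnn
      · simp only [F, h1.2 r1, zero_mul, norm_zero]; exact hnn
  have e1 : ∫ z, f z * (u₁ f z * p z.1) = ∫ q, F q := by
    have e0 : ∫ q, F q = ∫ z, ∫ ξ, F (z, ξ) := integral_prod F hF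
    rw [e0]
    congr 1; ext z
    simp only [F]
    rw [integral_const_mul]
    unfold u₁; ring
  have e2 : ∫ q, F q = ∫ q : Cyl × Cyl, F q.swap := (integral_prod_swap F).symm
  have hFs : Integrable fun q : Cyl × Cyl => F q.swap := hF.swap
  -- Adding the integral with exchanged variables and using that `k₁` is odd produces the difference
  -- `p x - p ξ₁`, which cancels the singularity.
  have e3 : 2 * ∫ q, F q = ∫ q : Cyl × Cyl, f q.1 * f q.2 * (k₁ (q.1 - q.2) * (p q.1.1 - p q.2.1)) := by
    rw [two_mul]
    nth_rw 2 [e2]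
    rw [← integral_add hF hFs]
    congr 1; ext q
    have : k₁ (q.2 - q.1) = -k₁ (q.1 - q.2) := by rw [← k₁_neg, neg_sub]
    simp only [F, Prod.fst_swap, Prod.snd_swap, this]
    ring
  let A : Cyl → ℝ := fun z => {z : Cyl | a / 2 < |z.1|}.indicator 1 z * f z
  have hA : Integrable A := by
    have : A = {z : Cyl | a / 2 < |z.1|}.indicator f := by
      ext z
      simp only [A]
      by_cases h : z ∈ {z : Cyl | a / 2 < |z.1|}
      · rw [indicator_of_mem h, indicator_of_mem h, Pi.one_apply, one_mul]
      · rw [indicator_of_notMem h, indicator_of_notMem h, zero_mul]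
    rw [this]
    exact hf.integrable.indicator (measurableSet_outer _)
  have i1 : Integrable fun q : Cyl × Cyl => A q.1 * A q.2 := hA.mul_prod hA
  have i2 : Integrable fun q : Cyl × Cyl => A q.1 * f q.2 := hA.mul_prod hf.integrable
  have i3 : Integrable fun q : Cyl × Cyl => f q.1 * A q.2 := hf.integrable.mul_prod hA
  have i4 : Integrable fun q : Cyl × Cyl =>
      2 * Real.exp (-a / 4) * (A q.1 * f q.2 + f q.1 * A q.2) := (i2.add i3).const_mul _
  have e4 : ∫ q : Cyl × Cyl, c * (A q.1 * A q.2 + 2 * Real.exp (-a / 4) *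
      (A q.1 * f q.2 + f q.1 * A q.2)) = c * (outerMass f (a / 2) ^ 2 +
        4 * Real.exp (-a / 4) * ((∫ z, f z) * outerMass f (a / 2))) := by
    have hprod : ∀ g h : Cyl → ℝ, ∫ q : Cyl × Cyl, g q.1 * h q.2 = (∫ z, g z) * ∫ z, h z :=
      fun g h => integral_prod_mul g h
    rw [integral_const_mul, integral_add i1 i4, integral_const_mul,
      integral_add i2 i3, hprod, hprod, hprod]
    have : ∫ z, A z = outerMass f (a / 2) := (outerMass_eq_integral_indicator f _).symm
    rw [this]; ring
  have key : |2 * ∫ q, F q| ≤ c * (outerMass f (a / 2) ^ 2 +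
        4 * Real.exp (-a / 4) * ((∫ z, f z) * outerMass f (a / 2))) := by
    rw [e3, ← e4, ← Real.norm_eq_abs]
    refine norm_integral_le_of_norm_le ((i1.add i4).const_mul c) ?_
    filter_upwards [hp1, hp2] with q h1 h2
    rw [Real.norm_eq_abs, abs_mul, abs_of_nonneg (mul_nonneg h1 h2)]
    calc _ ≤ f q.1 * f q.2 * _ := mul_le_mul_of_nonneg_left
          (abs_k₁_mul_sub_le ha hc hp hp0 q.1 q.2) (mul_nonneg h1 h2)
      _ = _ := by simp only [A]; ring
  rw [abs_mul, abs_two] at key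
  rw [e1]
  linarith

/-! ### The initial datum -/

/-- Each point off the essential support has a neighbourhood where `f` vanishes almost everywhere,
and a locally null set is null. -/
theorem ae_eq_zero_of_notMem_essSupport (f : Cyl → ℝ) :
    ∀ᵐ z : Cyl, z ∉ essSupport f → f z = 0 := by
  have h : volume {z : Cyl | z ∉ essSupport f ∧ f z ≠ 0} = 0 := by
    refine measure_null_of_locally_null _ fun z hz => ?_
    have hz' := hz.1
    simp only [essSupport, mem_ofPred_eq, not_forall, not_not] at hz'
    obtain ⟨U, hU, hfU⟩ := hz'
    refine ⟨interior U ∩ {z : Cyl | z ∉ essSupport f ∧ f z ≠ 0},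
      Filter.inter_mem (mem_nhdsWithin_of_mem_nhds (interior_mem_nhds.2 hU))
        self_mem_nhdsWithin, ?_⟩
    have h1 := (ae_restrict_iff' isOpen_interior.measurableSet).1
      (ae_restrict_of_ae_restrict_of_subset interior_subset hfU)
    refine measure_mono_null (fun w hw => ?_) h1
    simp only [mem_ofPred_eq, mem_compl_iff, Classical.not_imp]
    exact ⟨hw.1, hw.2.2⟩
  filter_upwards [measure_eq_zero_iff_ae_notMem.1 h] with z hz hz1
  by_contra h2
  exact hz ⟨hz1, h2⟩

theorem abs_sub_le_horizDiam {f : Cyl → ℝ} (hc : IsCompact (essSupport f)) {z ξ : Cyl}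
    (hz : z ∈ essSupport f) (hξ : ξ ∈ essSupport f) : |z.1 - ξ.1| ≤ horizDiam f := by
  refine le_csSup ?_ ⟨z, hz, ξ, hξ, rfl⟩
  -- Compactness makes the set of distances bounded above, without which its real supremum would not
  -- dominate its elements.
  obtain ⟨B, hB⟩ := hc.exists_bound_of_continuousOn (f := fun z : Cyl => z.1)
    continuous_fst.continuousOn
  refine ⟨B + B, ?_⟩
  rintro d ⟨z, hz, ξ, hξ, rfl⟩
  exact (abs_sub _ _).trans (add_le_add (hB z hz) (hB ξ hξ))

/-- A centred density of horizontal diameter at most one lives in the strip `|x| ≤ 1`. -/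
theorem bddStrip_one_of_centred {f : Cyl → ℝ} (hm : AEStronglyMeasurable f volume)
    (h01 : ∀ᵐ z, 0 ≤ f z ∧ f z ≤ 1) (hc : IsCompact (essSupport f)) (hd : horizDiam f ≤ 1)
    (hmass : 0 < ∫ z, f z) (hcentre : ∫ z : Cyl, z.1 * f z = 0) : BddStrip 1 1 f := by
  have hsupp := ae_eq_zero_of_notMem_essSupport f
  obtain ⟨B, hB⟩ := hc.exists_bound_of_continuousOn (f := fun z : Cyl => z.1)
    continuous_fst.continuousOn
  have hi : Integrable f := by
    by_contra h
    rw [integral_undef h] at hmass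
    exact hmass.false
  have hxi : Integrable fun z : Cyl => z.1 * f z := by
    refine (hi.abs.const_mul |B|).mono' (measurable_fst.aestronglyMeasurable.mul hm) ?_
    filter_upwards [hsupp] with z hz
    rw [norm_mul, Real.norm_eq_abs (f z)]
    by_cases h : z ∈ essSupport f
    · exact mul_le_mul_of_nonneg_right ((hB z h).trans (le_abs_self B)) (abs_nonneg _)
    · rw [hz h, abs_zero, mul_zero, mul_zero]
  have key : ∀ z ∈ essSupport f, |z.1| ≤ 1 := by
    intro z hz
    rw [abs_le]
    constructor
    -- If a support point had abscissa below `-1`, the diameter bound would put the whole support in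
    -- `x ≤ z.1 + 1 < 0`, contradicting a zero centre with positive mass.
    · by_contra hcon
      push Not at hcon
      have h1 : ∫ ξ : Cyl, ξ.1 * f ξ ≤ ∫ ξ : Cyl, (z.1 + 1) * f ξ := by
        refine integral_mono_ae hxi (hi.const_mul _) ?_
        filter_upwards [hsupp, h01] with ξ h2 h3
        by_cases hξ : ξ ∈ essSupport f
        · have := (abs_le.1 ((abs_sub_le_horizDiam hc hz hξ).trans hd)).1
          exact mul_le_mul_of_nonneg_right (by linarith) h3.1
        · rw [h2 hξ, mul_zero, mul_zero]
      rw [hcentre, integral_const_mul] at h1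
      nlinarith
    · by_contra hcon
      push Not at hcon
      have h1 : ∫ ξ : Cyl, (z.1 - 1) * f ξ ≤ ∫ ξ : Cyl, ξ.1 * f ξ := by
        refine integral_mono_ae (hi.const_mul _) hxi ?_
        filter_upwards [hsupp, h01] with ξ h2 h3
        by_cases hξ : ξ ∈ essSupport f
        · have := (abs_le.1 ((abs_sub_le_horizDiam hc hz hξ).trans hd)).2
          exact mul_le_mul_of_nonneg_right (by linarith) h3.1
        · rw [h2 hξ, mul_zero, mul_zero]
      rw [hcentre, integral_const_mul] at h1
      nlinarith
  refine ⟨zero_le_one, hm, ?_⟩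
  filter_upwards [hsupp, h01] with z h1 h2
  refine ⟨by rw [abs_of_nonneg h2.1]; exact h2.2, fun h => h1 fun hz => ?_⟩
  exact absurd (key z hz) (not_le.2 h)

/-! ### The horizontal cutoff -/

theorem exists_horizontal_cutoff : ∃ (η : ℝ → ℝ) (C : ℝ), 0 ≤ C ∧ ContDiff ℝ ∞ η ∧
    (∀ x, 0 ≤ η x) ∧ (∀ x, |x| ≤ 1 → η x = 0) ∧ (∀ x, 2 ≤ |x| → η x = 1) ∧
    ∀ x y, |deriv η x - deriv η y| ≤ C * |x - y| := by
  let b : ContDiffBump (0 : ℝ) := ⟨1, 2, one_pos, one_lt_two⟩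
  have hd : ContDiff ℝ 1 (deriv b) := by
    have h2 : ContDiff ℝ 2 b := b.contDiff
    exact ((contDiff_succ_iff_deriv (n := 1)).1 h2).2.2
  obtain ⟨C, hC⟩ := hd.lipschitzWith_of_hasCompactSupport b.hasCompactSupport.deriv one_ne_zero
  refine ⟨fun x => 1 - b x, C, C.2, contDiff_const.sub b.contDiff,
    fun x => sub_nonneg.2 b.le_one, fun x hx => ?_, fun x hx => ?_, fun x y => ?_⟩
  · simp only
    rw [b.one_of_mem_closedBall (by rw [mem_closedBall_zero_iff]; exact hx), sub_self]
  · simp only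
    rw [b.zero_of_le_dist (by rw [dist_zero_right]; exact hx), sub_zero]
  · have e : ∀ x, deriv (fun x => 1 - b x) x = -deriv b x := fun x => deriv_const_sub 1
    rw [e, e]
    have := hC.dist_le_mul x y
    rw [Real.dist_eq, Real.dist_eq] at this
    rwa [neg_sub_neg, abs_sub_comm]

/-! ### The main estimate -/

/-- Conservation of mass: the constant test function `1` has zero weak rate. -/
theorem IsWeakSolution.integral_eq {θ₀ : Cyl → ℝ} {θ : ℝ → Cyl → ℝ} (hθ : IsWeakSolution θ₀ θ)
    {T M R : ℝ} (hb : ∀ τ ∈ Icc 0 T, BddStrip M R (θ τ))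
    (hR : ∀ᵐ z : Cyl, R < |z.1| → θ₀ z = 0) {t : ℝ} (ht : t ∈ Icc 0 T) :
    ∫ z, θ t z = ∫ z, θ₀ z := by
  have hφ : SmoothTimeCyl fun _ _ => 1 := contDiff_const
  have h := hθ.weak_form_of_smooth hφ hb hR ht
  have h0 : ∀ τ, weakRate θ (fun _ _ => 1) τ = 0 := fun τ => by simp [weakRate, dt, dx, dy]
  simpa [h0] using h

theorem IsWeakSolution.aestronglyMeasurable_outerMass {θ₀ : Cyl → ℝ} {θ : ℝ → Cyl → ℝ}
    (hθ : IsWeakSolution θ₀ θ) (r : ℝ) :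
    AEStronglyMeasurable (fun τ => outerMass (θ τ) r) (volume.restrict (Ici (0 : ℝ))) := by
  obtain ⟨g, hg, hae⟩ := hθ.exists_stronglyMeasurable
  refine ⟨fun τ => ∫ z in {z : Cyl | r < |z.1|}, g (τ, z),
    hg.integral_prod_right' (ν := volume.restrict {z : Cyl | r < |z.1|}), ?_⟩
  filter_upwards [hae] with τ hτ
  exact integral_congr_ae (ae_restrict_of_ae hτ)

theorem outerMass_nonneg {f : Cyl → ℝ} (h : ∀ᵐ z, 0 ≤ f z) (r : ℝ) : 0 ≤ outerMass f r :=
  integral_nonneg_of_ae (ae_restrict_of_ae h)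

theorem outerMass_le_integral {f : Cyl → ℝ} (hf : Integrable f) (h : ∀ᵐ z, 0 ≤ f z) (r : ℝ) :
    outerMass f r ≤ ∫ z, f z :=
  setIntegral_le_integral hf h

theorem weakRate_horizontal (θ : ℝ → Cyl → ℝ) (χ : ℝ → ℝ) (τ : ℝ) :
    weakRate θ (fun _ z => χ z.1) τ = ∫ z, θ τ z * (u₁ (θ τ) z * deriv χ z.1) := by
  simp [weakRate, dt, dx, dy]

theorem outerMass_le_integral_cutoff {M R r : ℝ} {f : Cyl → ℝ} (hf : BddStrip M R f)
    (h : ∀ᵐ z, 0 ≤ f z) {χ : ℝ → ℝ} (hχ : Continuous χ) (h0 : ∀ x, 0 ≤ χ x)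
    (h1 : ∀ x, r ≤ |x| → χ x = 1) : outerMass f r ≤ ∫ z, f z * χ z.1 := by
  obtain ⟨P, hP⟩ := (isCompact_strip R).exists_bound_of_continuousOn
    (f := fun z : Cyl => χ z.1) (hχ.comp continuous_fst).continuousOn
  have hi : Integrable fun z : Cyl => f z * χ z.1 := by
    refine (hf.integrable.abs.mul_const |P|).mono'
      (hf.meas.mul (hχ.comp continuous_fst).aestronglyMeasurable) ?_
    filter_upwards [hf.bound] with z hz
    rw [norm_mul, Real.norm_eq_abs (f z)]
    rcases le_or_gt |z.1| R with hr | hr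
    · exact mul_le_mul_of_nonneg_left ((hP z hr).trans (le_abs_self P)) (abs_nonneg _)
    · rw [hz.2 hr, abs_zero, zero_mul, zero_mul]
  have e : outerMass f r = ∫ z in {z : Cyl | r < |z.1|}, f z * χ z.1 := by
    refine setIntegral_congr_fun (measurableSet_outer r) fun z hz => ?_
    simp only [h1 z.1 (le_of_lt hz), mul_one]
  rw [e]
  refine setIntegral_le_integral hi ?_
  filter_upwards [h] with z hz
  exact mul_nonneg hz (h0 _)

theorem IsWeakSolution.intervalIntegrable_outerMass {θ₀ : Cyl → ℝ} {θ : ℝ → Cyl → ℝ}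
    (hθ : IsWeakSolution θ₀ θ) {T M R : ℝ} (hT : 0 ≤ T)
    (hb : ∀ τ ∈ Icc 0 T, BddStrip M R (θ τ)) (hR : ∀ᵐ z : Cyl, R < |z.1| → θ₀ z = 0)
    (hpos : ∀ τ ∈ Icc 0 T, ∀ᵐ z, 0 ≤ θ τ z) (r c : ℝ) :
    IntervalIntegrable (fun τ => outerMass (θ τ) r ^ 2 + c * outerMass (θ τ) r) volume 0 T := by
  rw [intervalIntegrable_iff_integrableOn_Ioc_of_le hT]
  have hm : AEStronglyMeasurable (fun τ => outerMass (θ τ) r) (volume.restrict (Ioc 0 T)) :=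
    (hθ.aestronglyMeasurable_outerMass r).mono_measure
      (Measure.restrict_mono (fun x hx => hx.1.le) le_rfl)
  refine Integrable.mono' (integrable_const ((∫ z, θ₀ z) ^ 2 + |c| * ∫ z, θ₀ z))
    ((hm.pow 2).add (hm.const_mul c)) ?_
  filter_upwards [ae_restrict_mem measurableSet_Ioc] with τ hτ
  have hτ' : τ ∈ Icc 0 T := ⟨hτ.1.le, hτ.2⟩
  have h0 := outerMass_nonneg (hpos τ hτ') r
  have h1 := outerMass_le_integral (hb τ hτ').integrable (hpos τ hτ') r
  rw [hθ.integral_eq hb hR hτ'] at h1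
  refine (norm_add_le _ _).trans ?_
  rw [norm_mul, norm_pow, Real.norm_of_nonneg h0, Real.norm_eq_abs]
  gcongr

theorem IsWeakSolution.outerMass_le {θ₀ : Cyl → ℝ} {θ : ℝ → Cyl → ℝ} (hθ : IsWeakSolution θ₀ θ)
    {T M R m : ℝ} (hT : 0 ≤ T) (hb : ∀ τ ∈ Icc 0 T, BddStrip M R (θ τ))
    (hR : ∀ᵐ z : Cyl, R < |z.1| → θ₀ z = 0) (hpos : ∀ τ ∈ Icc 0 T, ∀ᵐ z, 0 ≤ θ τ z)
    (hm : ∫ z, θ₀ z ≤ m) (hm0 : 0 ≤ m) (h1 : ∀ᵐ z : Cyl, 1 < |z.1| → θ₀ z = 0)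
    {η : ℝ → ℝ} {C a : ℝ} (ha : 2 ≤ a) (hC : 0 ≤ C) (hη : ContDiff ℝ ∞ η) (hη0 : ∀ x, 0 ≤ η x)
    (hη1 : ∀ x, |x| ≤ 1 → η x = 0) (hη2 : ∀ x, 2 ≤ |x| → η x = 1)
    (hηC : ∀ x y, |deriv η x - deriv η y| ≤ C * |x - y|) :
    outerMass (θ T) (2 * a) ≤ C * (1 + 2 * m) * (a ^ 2)⁻¹ * ∫ τ in (0 : ℝ)..T,
      -- The factor `1 + 2 * m` absorbs the total mass multiplying the exponential term in the flux
      -- bound.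
      (outerMass (θ τ) (a / 2) ^ 2 + Real.exp (-a / 4) * outerMass (θ τ) (a / 2)) := by
  have ha0 : 0 < a := by linarith
  let χ : ℝ → ℝ := fun x => η (x / a)
  have hχ : ContDiff ℝ ∞ χ := hη.comp (contDiff_id.div_const a)
  have hχd : ∀ x, deriv χ x = deriv η (x / a) / a := fun x => by
    have h := ((hη.differentiable (by simp) (x / a)).hasDerivAt).comp x
      ((hasDerivAt_id x).div_const a)
    have e : deriv χ x = _ := h.deriv
    rw [e]; ring
  -- One factor `1 / a` comes from differentiating `η (x / a)`, the other from the rescaled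
  -- argument.
  have hχC : ∀ x y, |deriv χ x - deriv χ y| ≤ C * (a ^ 2)⁻¹ * |x - y| := by
    intro x y
    rw [hχd, hχd, ← sub_div, abs_div, abs_of_pos ha0, div_le_iff₀ ha0]
    refine (hηC _ _).trans_eq ?_
    rw [← sub_div, abs_div, abs_of_pos ha0]
    field_simp
  have hχ0 : ∀ x, |x| < a → deriv χ x = 0 := by
    intro x hx
    have : χ =ᶠ[𝓝 x] fun _ => 0 := by
      filter_upwards [(isOpen_lt continuous_abs continuous_const).mem_nhds hx] with y hy
      refine hη1 _ ?_
      rw [abs_div, abs_of_pos ha0, div_le_one ha0]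
      exact le_of_lt hy
    rw [this.deriv_eq, deriv_const]
  have hφ : SmoothTimeCyl fun _ z => χ z.1 :=
    ContDiff.comp (f := fun p : ℝ × ℝ × ℝ => p.2.1) hχ (contDiff_fst.comp contDiff_snd)
  have hTT : T ∈ Icc 0 T := ⟨hT, le_rfl⟩
  have hw := hθ.weak_form_of_smooth hφ hb hR hTT
  -- The datum lives in `|x| ≤ 1`, where the cutoff at scale `a ≥ 2` vanishes.
  have hinit : ∫ z : Cyl, θ₀ z * χ z.1 = 0 := by
    refine integral_eq_zero_of_ae ?_
    filter_upwards [h1] with z hz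
    rcases le_or_gt |z.1| 1 with h | h
    · have : χ z.1 = 0 := by
        refine hη1 _ ?_
        rw [abs_div, abs_of_pos ha0, div_le_one ha0]
        linarith
      simp [this]
    · simp [hz h]
  rw [hinit, zero_add] at hw
  have hout := outerMass_le_integral_cutoff (r := 2 * a) (hb T hTT) (hpos T hTT) hχ.continuous
    (fun x => hη0 _) fun x hx => hη2 _ (by
      rw [abs_div, abs_of_pos ha0, le_div_iff₀ ha0]; exact hx)
  refine (hout.trans_eq hw).trans ?_
  rw [← intervalIntegral.integral_const_mul]
  refine intervalIntegral.integral_mono_on hT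
    (hθ.intervalIntegrable_weakRate hφ hb le_rfl hT le_rfl)
    ((hθ.intervalIntegrable_outerMass hT hb hR hpos (a / 2) (Real.exp (-a / 4))).const_mul _)
    fun τ hτ => ?_
  have hc : 0 ≤ C * (a ^ 2)⁻¹ := by positivity
  have hflux := (hb τ hτ).abs_integral_flux_le (hpos τ hτ) ha hc
    (hχ.continuous_deriv (by simp)) hχC hχ0
  rw [weakRate_horizontal]
  refine (le_abs_self _).trans (hflux.trans ?_)
  rw [hθ.integral_eq hb hR hτ]
  have h0 := outerMass_nonneg (hpos τ hτ) (a / 2)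
  set μ := outerMass (θ τ) (a / 2)
  have he := Real.exp_pos (-a / 4)
  set q := Real.exp (-a / 4)
  have hq : (∫ z, θ₀ z) * μ ≤ m * μ := mul_le_mul_of_nonneg_right hm h0
  calc C * (a ^ 2)⁻¹ * (μ ^ 2 + 4 * q * ((∫ z, θ₀ z) * μ)) / 2
      ≤ C * (a ^ 2)⁻¹ * (μ ^ 2 + 4 * q * (m * μ)) / 2 := by gcongr
    _ ≤ C * (a ^ 2)⁻¹ * (2 * ((1 + 2 * m) * (μ ^ 2 + q * μ))) / 2 := by
        gcongr
        nlinarith [sq_nonneg μ, mul_nonneg hm0 (sq_nonneg μ), mul_nonneg he.le h0,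
          mul_nonneg hm0 (mul_nonneg he.le h0)]
    _ = _ := by ring

end CylinderEuler

theorem lemma4p1 :
    ∃ C : ℝ, 0 < C ∧
      ∀ (θ₀ : CylinderEuler.Cyl → ℝ) (θ : ℝ → CylinderEuler.Cyl → ℝ),
        AEStronglyMeasurable θ₀ volume →
        (∀ᵐ z : CylinderEuler.Cyl, 0 ≤ θ₀ z ∧ θ₀ z ≤ 1) →
        IsCompact (CylinderEuler.essSupport θ₀) →
        CylinderEuler.horizDiam θ₀ ≤ 1 →
        0 < ∫ z : CylinderEuler.Cyl, θ₀ z →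
        ∫ z : CylinderEuler.Cyl, z.1 * θ₀ z = 0 →
        CylinderEuler.IsWeakSolution θ₀ θ →
        ∀ a : ℕ, 0 < a → Even a → ∀ t : ℝ, 0 ≤ t →
          CylinderEuler.outerMass (θ t) (2 * (a : ℝ)) ≤
            C * ((a : ℝ) ^ 2)⁻¹ *
              ∫ τ in (0 : ℝ)..t,
                ((CylinderEuler.outerMass (θ τ) ((a : ℝ) / 2)) ^ 2 +
                  Real.exp (-(a : ℝ) / 4) *
                    CylinderEuler.outerMass (θ τ) ((a : ℝ) / 2)) := by
  open CylinderEuler in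
  obtain ⟨η, C, hC, hη, hη0, hη1, hη2, hηC⟩ := exists_horizontal_cutoff
  have hV := stripVol_nonneg 1
  -- The area of the strip `|x| ≤ 1` bounds the mass of every admissible datum, so the constant is
  -- absolute; `C + 1` replaces `C`, known only to be nonnegative, to make it positive.
  refine ⟨(C + 1) * (1 + 2 * stripVol 1), by positivity, ?_⟩
  intro θ₀ θ hm h01 hc hd hmass hcentre hθ a ha heven t ht
  have hf₀ := bddStrip_one_of_centred hm h01 hc hd hmass hcentre
  -- Evenness and positivity give `a ≥ 2`, hence `a / 2 ≥ 1`, as the exponential decay of the kernel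
  -- requires.
  have ha2 : (2 : ℝ) ≤ a := by
    obtain ⟨k, rfl⟩ := heven
    exact_mod_cast (by omega : 2 ≤ k + k)
  obtain ⟨M, R, hMR⟩ := hθ.bounded_compact t
  -- The maxima make the bound nonnegative and the strip wide enough to contain the datum as well.
  have hb : ∀ τ ∈ Icc 0 t, BddStrip (max M 0) (max R 1) (θ τ) := fun τ hτ =>
    ⟨le_max_right _ _, hθ.aestronglyMeasurable_slice τ hτ.1, by
      filter_upwards [hMR τ hτ] with z hz
      exact ⟨hz.1.trans (le_max_left _ _), fun h => hz.2 ((le_max_left _ _).trans_lt h)⟩⟩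
  have h1 : ∀ᵐ z : Cyl, 1 < |z.1| → θ₀ z = 0 := hf₀.bound.mono fun z hz => hz.2
  have hR : ∀ᵐ z : Cyl, max R 1 < |z.1| → θ₀ z = 0 :=
    h1.mono fun z hz h => hz ((le_max_right _ _).trans_lt h)
  have hpos := hθ.ae_nonneg (le_max_right _ _) hb hR (h01.mono fun z hz => hz.1)
  have hle : ∫ z, θ₀ z ≤ stripVol 1 := by
    have := hf₀.abs_integral_mul_le (g := fun _ => 1) (B := 1) fun z _ => by simp
    simp only [mul_one, one_mul] at this
    exact (le_abs_self _).trans this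
  exact hθ.outerMass_le ht hb hR hpos hle hV h1 ha2 (by linarith) hη hη0 hη1 hη2
    fun x y => (hηC x y).trans (mul_le_mul_of_nonneg_right (by linarith) (abs_nonneg _))
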